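/- Let $p\ge 0$, $[p]=\{1,\dots,p\}$, and let $\mathbf X$ be a random vector with values in $[-1,1]^p$ whose law is $\mu_f=f\lambda$, where $\lambda$ is Lebesgue measure on $[-1,1]^p$ and the (measurable) density $f$ satisfies $0<c_1\le f(\mathbf x)\le c_2<\infty$ for all $\mathbf x\in[-1,1]^p$. Write $L^2=L^2([-1,1]^p,\mu_f)$ (real valued functions), and for $S\subseteq[p]$ let $L^2_S\subseteq L^2$ be the subspace of functions of $\mathbf x_S=(x_j)_{j\in S}$ only, and let $f_S(\mathbf x_S)=\int_{[-1,1]^{[p]\setminus S}} f(\mathbf x)\,d\mathbf x_{[p]\setminus S}$ be the marginal density of $\mathbf X_S$. Let $P_m$ be the Legendre polynomials ($P_0=1$, $P_1=X$, $(m+1)P_{m+1}=(2m+1)XP_m-mP_{m-1}$ for $m\ge1$) and $\widetilde P_m=\sqrt{(2m+1)/2}\,P_m$. For $\emptyset\ne S\subseteq[p]$ and $\mathbf m_S=(m_j)_{j\in S}\in\mathbb N_+^{S}$ (positive integers) put $$\xi_S^{(\mathbf m_S)}(\mathbf x)=\frac{1}{\sqrt{2^{p-|S|}}}\cdot\frac{\prod_{j\in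 S}\widetilde P_{m_j}(x_j)}{f_S(\mathbf x_S)},$$ and let $\xi_\emptyset$ be the constant function $1$ or the constant function $2^{-p/2}$ (the value of the formula at $S=\emptyset$); the statement holds for either normalization. Call a family $(g_S)_{S\subseteq[p]}$ with $g_S\in L^2_S$ for all $S$ feasible (hierarchically orthogonal) if $\int g_S\,h\,d\mu_f=0$ for all $T\subsetneq S\subseteq[p]$ and all $h\in L^2_T$. Then all $\xi_S^{(\mathbf m_S)}$ belong to $L^2$, and the family $\Xi=(\xi_S^{(\mathbf m_S)})_{S\subseteq[p],\,\mathbf m_S\in\mathbb N_+^S}$ is a Riesz basis of $L^2$, i.e. the image of an orthonormal Hilbert basis of $L^2$ under a bounded linear automorphism of $L^2$ with bounded inverse. Moreover, for every $\nu\in L^2$ there are coefficients $\mathbf a=(a_S^{(\mathbf m_S)})$ and components $(\nu_S)_{S\subseteq[p]}$ such that: 1. $\mathbf a$ is the unique family of reals with $\nu=\sum_{S\subseteq[p]}\sum_{\mathbf m_S} a_S^{(\mathbf m_S)}\xi_S^{(\mathbf m_S)}$ (unconditional convergence in $L^2$); 2. $(\nu_S)_S$ is the unique minimizer of $\int\big(\sum_{S\subseteq[p]}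 g_S-\nu\big)^2d\mu_f$ over all feasible families $(g_S)_S$; 3. $(\nu_S)_S$ is the unique feasible family with $\nu=\sum_{S\subseteq[p]}\nu_S$; 4. $\mathbf a$ is the unique family of reals with $\nu_S=\sum_{\mathbf m_S\in\mathbb N_+^{S}}a_S^{(\mathbf m_S)}\xi_S^{(\mathbf m_S)}$ for all $S\subseteq[p]$ (unconditional convergence in $L^2$). -/

import Mathlib

open MeasureTheory

noncomputable section

namespace FANOVA

/-- The Legendre polynomials on `[-1,1]`, by the three-term recurrence
`(m+1) P_{m+1} = (2m+1) X P_m - m P_{m-1}` (read with `m = n + 1`). -/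
def legendre : ℕ → Polynomial ℝ
  | 0 => 1
  | 1 => Polynomial.X
  | n + 2 => Polynomial.C (1 / ((n : ℝ) + 2)) *
      (Polynomial.C (2 * (n : ℝ) + 3) * Polynomial.X * legendre (n + 1)
        - Polynomial.C ((n : ℝ) + 1) * legendre n)

/-- The normalized Legendre polynomial `√((2m+1)/2) P_m`, as a function. -/
def normLegendre (m : ℕ) (t : ℝ) : ℝ :=
  Real.sqrt ((2 * (m : ℝ) + 1) / 2) * (legendre m).eval t

/-- The measure `μ_f = f λ` on the cube `[-1,1]^p`, the law of the random vector with density `f`.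
Only the values of `f` on the cube matter. -/
def muF {p : ℕ} (f : (Fin p → ℝ) → ℝ) : Measure (Fin p → ℝ) :=
  (volume.restrict (Set.Icc (-1) 1)).withDensity (fun x => ENNReal.ofReal (f x))

/-- The Hilbert space `L² = L²([-1,1]^p, μ_f)`. -/
abbrev L2 {p : ℕ} (f : (Fin p → ℝ) → ℝ) : Type := Lp ℝ 2 (muF f)

/-- The marginal density `f_S(x_S)`: the integral of `f` over the coordinates outside `S`. -/
def marginal {p : ℕ} (f : (Fin p → ℝ) → ℝ) (S : Finset (Fin p)) (xS : {j // j ∈ S} → ℝ) : ℝ :=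
  ∫ y : ({j // ¬ j ∈ S} → ℝ) in Set.Icc (-1) 1,
    f ((MeasurableEquiv.piEquivPiSubtypeProd (fun _ : Fin p => ℝ) (fun j => j ∈ S)).symm (xS, y))

/-- The index set of the family `Ξ`: pairs `(S, m_S)` with `S ⊆ [p]` and `m_S ∈ ℕ₊^S`. -/
abbrev Idx (p : ℕ) : Type := Σ S : Finset (Fin p), ({j // j ∈ S} → ℕ+)

/-- The function `ξ_S^{(m_S)} = 2^{-(p-|S|)/2} ∏_{j ∈ S} P̃_{m_j}(x_j) / f_S(x_S)` for nonempty `S`;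
`κ` is the value of the constant function `ξ_∅`. (The general formula would give
`κ = 2^{-p/2}` at `S = ∅`, another usual normalization is `κ = 1`.) -/
def xi {p : ℕ} (f : (Fin p → ℝ) → ℝ) (κ : ℝ) (i : Idx p) (x : Fin p → ℝ) : ℝ :=
  if i.1 = ∅ then κ
  else 1 / Real.sqrt (2 ^ (p - i.1.card)) *
    ((∏ j : {j // j ∈ i.1}, normLegendre (i.2 j) (x j)) / marginal f i.1 (i.1.restrict x))

/-- A family is a Riesz basis if it is the image of a Hilbert (orthonormal) basis under a bounded
invertible linear operator. -/
def IsRieszBasis {ι H : Type} [NormedAddCommGroup H] [InnerProductSpace ℝ H] (v : ι → H) : Prop :=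
  ∃ (b : HilbertBasis ι ℝ H) (T : H ≃L[ℝ] H), ∀ i, v i = T (b i)

/-- `L²_S`: the square integrable functions that depend on `x_S` only. -/
def L2S {p : ℕ} (f : (Fin p → ℝ) → ℝ) (S : Finset (Fin p)) : Submodule ℝ (L2 f) where
  carrier := {g | ∃ h : ({j // j ∈ S} → ℝ) → ℝ, Measurable h ∧
    ∀ᵐ x ∂(muF f), g x = h (S.restrict x)}
  zero_mem' := ⟨0, measurable_zero, by
    filter_upwards [Lp.coeFn_zero ℝ 2 (muF f)] with x hx
    simpa using hx⟩
  add_mem' := by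
    rintro a b ⟨h, hm, hh⟩ ⟨k, km, hk⟩
    refine ⟨h + k, hm.add km, ?_⟩
    filter_upwards [Lp.coeFn_add a b, hh, hk] with x hx h1 h2
    rw [hx, Pi.add_apply, h1, h2, Pi.add_apply]
  smul_mem' := by
    rintro c a ⟨h, hm, hh⟩
    refine ⟨c • h, hm.const_smul c, ?_⟩
    filter_upwards [Lp.coeFn_smul c a, hh] with x hx h1
    rw [hx, Pi.smul_apply, h1, Pi.smul_apply]

/-- The feasible families of the generalized functional ANOVA problem: `g_S ∈ L²_S` for all `S`,
together with the hierarchical orthogonality constraint. -/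
def Feasible {p : ℕ} (f : (Fin p → ℝ) → ℝ) (g : Finset (Fin p) → L2 f) : Prop :=
  (∀ S, g S ∈ L2S f S) ∧
    ∀ T S : Finset (Fin p), T ⊂ S → ∀ h ∈ L2S f T, ∫ x, g S x * h x ∂(muF f) = 0

/-- The objective `∫ (∑_S g_S - ν)² dμ_f`. -/
def objective {p : ℕ} (f : (Fin p → ℝ) → ℝ) (ν : L2 f) (g : Finset (Fin p) → L2 f) : ℝ :=
  ∫ x, ((∑ S, g S x) - ν x) ^ 2 ∂(muF f)

/-- `g` solves the constrained least-squares problem that defines the generalized functional ANOVA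
decomposition of `ν`. -/
def IsSolution {p : ℕ} (f : (Fin p → ℝ) → ℝ) (ν : L2 f) (g : Finset (Fin p) → L2 f) : Prop :=
  Feasible f g ∧ ∀ g', Feasible f g' → objective f ν g ≤ objective f ν g'

end FANOVA

end

open MeasureTheory FANOVA

/-
Let `V_S` be the space of functions of `x_S` that are orthogonal to all functions of fewer of these
variables. The Legendre tensor products divided by `√f` form an orthonormal basis `e` of `L²`, and
multiplication by `√f / f_S` carries the block of `e` with index `S` onto `V_S` and, up to a
constant, its members to the `ξ_S^{(m_S)}`. It remains to see that the blockwise defined operator is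
invertible, although the spaces `V_S` are not orthogonal to each other.

A tensor product in which some variable outside `T` occurs integrates to zero against all functions
of `x_T`. Hence, for the coercive form `(g, h) ↦ ∫ g h f_S`, the space `V_S` is orthogonal to every
`L²_T` with `S ⊄ T`, and so `‖v‖ ≤ C ‖v + u‖` for `v ∈ V_S` and `u` in the sum of the `V_T` with
`S ⊄ T`. Descending induction on `S` yields `‖g_S‖ ≤ K ‖∑_T g_T‖` for all feasible families. So the
operator is bounded below; its range is closed and contains every `V_S`, and the span of these is
dense. The same inequality shows that feasible families are determined by their sums.
-/

noncomputable section

namespace FANOVA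

section RieszBasis

variable {ι E : Type} [NormedAddCommGroup E] [InnerProductSpace ℝ E]

theorem hasSum_smul_hilbertBasis_iff (b : HilbertBasis ι ℝ E) {x : E} {c : ι → ℝ} :
    HasSum (fun i => c i • b i) x ↔ c = b.repr x := by
  constructor
  · intro h
    funext i
    have hi := h.mapL (innerSL ℝ (b i))
    simp only [innerSL_apply_apply, real_inner_smul_right] at hi
    have hsingle := hasSum_single i fun j hj => show c j * inner ℝ (b i) (b j) = 0 by
      rw [b.orthonormal.inner_eq_zero hj.symm, mul_zero]
    rw [b.repr_apply_apply, hi.unique hsingle, real_inner_self_eq_norm_sq, b.orthonormal.1 i]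
    norm_num
  · rintro rfl
    exact b.hasSum_repr x

theorem IsRieszBasis.exists_hasSum_iff {v : ι → E} (hv : IsRieszBasis v) (x : E) :
    ∃ a : ι → ℝ, ∀ c : ι → ℝ, HasSum (fun i => c i • v i) x ↔ c = a := by
  obtain ⟨b, T, hT⟩ := hv
  refine ⟨b.repr (T.symm x), fun c => ?_⟩
  rw [← hasSum_smul_hilbertBasis_iff]
  simp only [hT, ← map_smul]
  exact T.hasSum

end RieszBasis

section FiniteSigma

theorem hasSum_sigma_of_fintype {ι E : Type*} {κ : ι → Type*} [Fintype ι] [AddCommMonoid E]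
    [TopologicalSpace E] [ContinuousAdd E] {u : (Σ i, κ i) → E} {g : ι → E}
    (h : ∀ i, HasSum (fun k => u ⟨i, k⟩) (g i)) :
    HasSum u (∑ i, g i) := by
  classical
  have hfiber (i : ι) : HasSum (fun s : Σ i, κ i => if s.1 = i then u s else 0) (g i) := by
    refine (sigma_mk_injective (i := i).hasSum_iff ?_).1 (by simpa [Function.comp_def] using h i)
    rintro ⟨j, k⟩ hs
    rw [if_neg]
    rintro rfl
    exact hs ⟨k, rfl⟩
  simpa using hasSum_sum fun i (_ : i ∈ Finset.univ) => hfiber i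

theorem mem_of_hasSum_smul {ι E : Type*} [AddCommGroup E] [Module ℝ E]
    [TopologicalSpace E] {V : Submodule ℝ E} (hV : IsClosed (V : Set E)) {v : ι → E}
    (hv : ∀ i, v i ∈ V)
    {c : ι → ℝ} {x : E} (hx : HasSum (fun i => c i • v i) x) : x ∈ V :=
  hV.mem_of_tendsto hx (.of_forall fun _ => V.sum_mem fun i _ => V.smul_mem _ (hv i))

theorem IsRieszBasis.exists_hasSum_fiber_iff {ι E : Type} {κ : ι → Type} [Fintype ι]
    [NormedAddCommGroup E] [InnerProductSpace ℝ E] [CompleteSpace E]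
    {v : (Σ i, κ i) → E} (hv : IsRieszBasis v) {V : ι → Submodule ℝ E}
    (hclosed : ∀ i, IsClosed (V i : Set E)) (hmem : ∀ s, v s ∈ V s.1)
    (hindep : ∀ g g' : ι → E, (∀ i, g i ∈ V i) → (∀ i, g' i ∈ V i) →
      ∑ i, g i = ∑ i, g' i → g = g') (x : E) :
    ∃ (a : (Σ i, κ i) → ℝ) (g : ι → E),
      (∀ c : (Σ i, κ i) → ℝ, HasSum (fun s => c s • v s) x ↔ c = a) ∧
      (∀ g' : ι → E, ((∀ i, g' i ∈ V i) ∧ ∑ i, g' i = x) ↔ g' = g) ∧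
      ∀ c : (Σ i, κ i) → ℝ,
        (∀ i, HasSum (fun k => c ⟨i, k⟩ • v ⟨i, k⟩) (g i)) ↔ c = a := by
  obtain ⟨a, ha⟩ := hv.exists_hasSum_iff x
  have hsum := (ha a).2 rfl
  let g (i : ι) : E := ∑' k, a ⟨i, k⟩ • v ⟨i, k⟩
  have hg (i : ι) : HasSum (fun k => a ⟨i, k⟩ • v ⟨i, k⟩) (g i) :=
    (hsum.summable.sigma_factor i).hasSum
  have hgV (i : ι) : g i ∈ V i := mem_of_hasSum_smul (hclosed i) (fun k => hmem ⟨i, k⟩) (hg i)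
  have hgx : ∑ i, g i = x := (hasSum_sigma_of_fintype hg).unique hsum
  refine ⟨a, g, ha, fun g' => ⟨fun h => ?_, ?_⟩, fun c => ⟨fun h => ?_, ?_⟩⟩
  · exact hindep g' g h.1 hgV (h.2.trans hgx.symm)
  · rintro rfl
    exact ⟨hgV, hgx⟩
  · exact (ha c).1 (hgx ▸ hasSum_sigma_of_fintype h)
  · rintro rfl
    exact hg

end FiniteSigma

section HierarchicalPart

variable {ι E : Type*} [NormedAddCommGroup E] [InnerProductSpace ℝ E]

/-- The hierarchical part of `L i` in a family of subspaces indexed by an ordered set: the elements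
of `L i` that are orthogonal to all `L j` with `j < i`. -/
def hierarchicalPart [LT ι] (L : ι → Submodule ℝ E) (i : ι) : Submodule ℝ E :=
  L i ⊓ ⨅ j, ⨅ _ : j < i, (L j)ᗮ

theorem mem_hierarchicalPart [LT ι] {L : ι → Submodule ℝ E} {i : ι} {x : E} :
    x ∈ hierarchicalPart L i ↔ x ∈ L i ∧ ∀ j < i, ∀ y ∈ L j, inner ℝ x y = 0 := by
  simp only [hierarchicalPart, Submodule.mem_inf, Submodule.mem_iInf, Submodule.mem_orthogonal']

theorem isClosed_hierarchicalPart [LT ι] {L : ι → Submodule ℝ E}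
    (hL : ∀ i, IsClosed (L i : Set E)) (i : ι) : IsClosed (hierarchicalPart L i : Set E) := by
  simp only [hierarchicalPart, Submodule.coe_inf, Submodule.coe_iInf]
  exact (hL i).inter (isClosed_iInter fun j => isClosed_iInter fun _ => (L j).isClosed_orthogonal)

theorem le_topologicalClosure_iSup_hierarchicalPart [Preorder ι] [WellFoundedLT ι]
    [CompleteSpace E] {L : ι → Submodule ℝ E} (hmono : Monotone L)
    (hL : ∀ i, IsClosed (L i : Set E)) (i : ι) :
    L i ≤ (⨆ j, hierarchicalPart L j).topologicalClosure := by
  set K := (⨆ j, hierarchicalPart L j).topologicalClosure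
  induction i using WellFoundedLT.induction with
  | ind i ih =>
    let W := (⨆ j, ⨆ _ : j < i, L j).topologicalClosure
    have : W.HasOrthogonalProjection :=
      haveI : CompleteSpace W := (Submodule.isClosed_topologicalClosure _).completeSpace_coe
      inferInstance
    have hWK : W ≤ K :=
      Submodule.topologicalClosure_minimal _ (iSup₂_le ih) (Submodule.isClosed_topologicalClosure _)
    have hWL : W ≤ L i :=
      Submodule.topologicalClosure_minimal _ (iSup₂_le fun j hj => hmono hj.le) (hL i)
    have hLW (j : ι) (hj : j < i) : L j ≤ W :=
      (le_iSup₂ (f := fun j _ => L j) j hj).trans (Submodule.le_topologicalClosure _)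
    intro x hx
    have hproj : W.starProjection x ∈ W := Submodule.starProjection_apply_mem W x
    have hrest : x - W.starProjection x ∈ hierarchicalPart L i :=
      mem_hierarchicalPart.2 ⟨sub_mem hx (hWL hproj), fun j hj y hy =>
        Submodule.inner_left_of_mem_orthogonal (hLW j hj hy)
          (Submodule.sub_starProjection_mem_orthogonal x)⟩
    rw [← add_sub_cancel (W.starProjection x) x]
    exact add_mem (hWK hproj) (Submodule.le_topologicalClosure _
      (Submodule.mem_iSup_of_mem i hrest))

end HierarchicalPart

section Angle

variable {ι E : Type*} [NormedAddCommGroup E] [InnerProductSpace ℝ E]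

-- A skew projection bound: `v` and `u` need not be orthogonal for the inner product, but they are
-- for the coercive (possibly nonsymmetric) form given by `D`.
theorem norm_le_mul_norm_add_of_coercive {D : E →L[ℝ] E} {c : ℝ} (hc : 0 < c)
    (hD : ∀ x, c * ‖x‖ ^ 2 ≤ inner ℝ x (D x)) {v u : E} (hvu : inner ℝ v (D u) = 0) :
    ‖v‖ ≤ ‖D‖ / c * ‖v + u‖ := by
  have hsq : c * ‖v‖ ^ 2 ≤ ‖v‖ * (‖D‖ * ‖v + u‖) :=
    calc c * ‖v‖ ^ 2 ≤ inner ℝ v (D v) := hD v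
      _ = inner ℝ v (D (v + u)) := by rw [map_add, inner_add_right, hvu, add_zero]
      _ ≤ ‖v‖ * (‖D‖ * ‖v + u‖) :=
        (real_inner_le_norm _ _).trans (by gcongr; exact D.le_opNorm _)
  rcases (norm_nonneg v).eq_or_lt' with h0 | hpos
  · rw [h0]
    positivity
  · rw [div_mul_eq_mul_div, le_div_iff₀ hc]
    refine le_of_mul_le_mul_left ?_ hpos
    linarith

theorem exists_norm_le_mul_norm_sum [Fintype ι] [PartialOrder ι] {V : ι → Submodule ℝ E}
    (hangle : ∀ i, ∃ C : ℝ, ∀ v ∈ V i, ∀ u ∈ ⨆ j, ⨆ _ : ¬ i ≤ j, V j, ‖v‖ ≤ C * ‖v + u‖) :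
    ∃ K : ℝ, ∀ g : ι → E, (∀ i, g i ∈ V i) → ∀ i, ‖g i‖ ≤ K * ‖∑ j, g j‖ := by
  classical
  have hbound (i : ι) : ∃ K : ℝ, ∀ g : ι → E, (∀ i, g i ∈ V i) → ‖g i‖ ≤ K * ‖∑ j, g j‖ := by
    induction i using WellFoundedGT.induction with
    | ind i ih =>
      choose! K hK using ih
      obtain ⟨C, hC⟩ := hangle i
      refine ⟨|C| * (1 + ∑ j with i < j, K j), fun g hg => ?_⟩
      have hu : ∑ j with ¬ i ≤ j, g j ∈ ⨆ j, ⨆ _ : ¬ i ≤ j, V j :=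
        Submodule.sum_mem _ fun j hj =>
          Submodule.mem_iSup_of_mem j (Submodule.mem_iSup_of_mem (Finset.mem_filter.1 hj).2 (hg j))
      have hsplit : g i + ∑ j with ¬ i ≤ j, g j = ∑ j, g j - ∑ j with i < j, g j := by
        rw [eq_sub_iff_add_eq, ← Finset.sum_filter_add_sum_filter_not Finset.univ (i ≤ ·) g,
          add_right_comm, ← Finset.sum_insert (by simp)]
        congr 2
        ext j
        simp [le_iff_eq_or_lt, eq_comm]
      calc ‖g i‖ ≤ C * ‖g i + ∑ j with ¬ i ≤ j, g j‖ := hC _ (hg i) _ hu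
        _ ≤ |C| * (‖∑ j, g j‖ + ∑ j with i < j, ‖g j‖) := by
          rw [hsplit]
          gcongr
          · exact le_abs_self C
          · exact (norm_sub_le _ _).trans (by gcongr; exact norm_sum_le _ _)
        _ ≤ |C| * (‖∑ j, g j‖ + ∑ j with i < j, K j * ‖∑ j, g j‖) := by
          gcongr with j hj
          exact hK j (Finset.mem_filter.1 hj).2 g hg
        _ = |C| * (1 + ∑ j with i < j, K j) * ‖∑ j, g j‖ := by
          rw [← Finset.sum_mul]
          ring
  choose K hK using hbound
  refine ⟨∑ i, |K i|, fun g hg i => (hK i g hg).trans ?_⟩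
  gcongr
  exact (le_abs_self _).trans
    (Finset.single_le_sum (f := fun i => |K i|) (fun _ _ => abs_nonneg _) (Finset.mem_univ i))

theorem eq_of_sum_eq_of_norm_le [Fintype ι] {V : ι → Submodule ℝ E} {K : ℝ}
    (hK : ∀ g : ι → E, (∀ i, g i ∈ V i) → ∀ i, ‖g i‖ ≤ K * ‖∑ j, g j‖) {g g' : ι → E}
    (hg : ∀ i, g i ∈ V i) (hg' : ∀ i, g' i ∈ V i) (h : ∑ i, g i = ∑ i, g' i) : g = g' := by
  funext i
  have := hK (g - g') (fun i => sub_mem (hg i) (hg' i)) i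
  simp only [Pi.sub_apply, Finset.sum_sub_distrib, h, sub_self, norm_zero, mul_zero] at this
  exact sub_eq_zero.1 (norm_le_zero_iff.1 this)

end Angle

section Block

variable {ι E : Type*} {κ : ι → Type*} [NormedAddCommGroup E] [InnerProductSpace ℝ E]
  (b : HilbertBasis (Σ i, κ i) ℝ E)

/-- The closed span of the `i`-th block of a Hilbert basis indexed by a sigma type, encoded as the
orthogonal complement of the other basis vectors. -/
def basisBlock (i : ι) : Submodule ℝ E :=
  ⨅ s : Σ i, κ i, ⨅ _ : s.1 ≠ i, (ℝ ∙ b s)ᗮ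

variable {b}

theorem mem_basisBlock {i : ι} {x : E} :
    x ∈ basisBlock b i ↔ ∀ s : Σ i, κ i, s.1 ≠ i → inner ℝ (b s) x = 0 := by
  simp only [basisBlock, Submodule.mem_iInf, Submodule.mem_orthogonal_singleton_iff_inner_right]

theorem isClosed_basisBlock (i : ι) : IsClosed (basisBlock b i : Set E) := by
  simp only [basisBlock, Submodule.coe_iInf]
  exact isClosed_iInter fun s => isClosed_iInter fun _ => Submodule.isClosed_orthogonal _

theorem hilbertBasis_mem_basisBlock (s : Σ i, κ i) : b s ∈ basisBlock b s.1 :=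
  mem_basisBlock.2 fun _ ht => b.orthonormal.inner_eq_zero fun h => ht (congrArg Sigma.fst h)

theorem inner_eq_zero_of_mem_basisBlock {i j : ι} (hij : i ≠ j) {x y : E}
    (hx : x ∈ basisBlock b i) (hy : y ∈ basisBlock b j) : inner ℝ x y = 0 := by
  rw [← b.tsum_inner_mul_inner x y]
  refine (tsum_congr fun s => ?_).trans tsum_zero
  by_cases hs : s.1 = i
  · rw [mem_basisBlock.1 hy s (hs ▸ hij), mul_zero]
  · rw [real_inner_comm, mem_basisBlock.1 hx s hs, zero_mul]

theorem map_mem_of_mem_basisBlock {F : Type*} [AddCommGroup F] [Module ℝ F] [TopologicalSpace F]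
    {W : Submodule ℝ F} (hW : IsClosed (W : Set F)) {i : ι} {M : E →L[ℝ] F}
    (hM : ∀ k, M (b ⟨i, k⟩) ∈ W) {x : E} (hx : x ∈ basisBlock b i) : M x ∈ W := by
  refine hW.mem_of_tendsto (M.hasSum (b.hasSum_repr x))
    (.of_forall fun t => W.sum_mem fun ⟨j, k⟩ _ => ?_)
  by_cases hj : j = i
  · subst hj
    simpa using W.smul_mem _ (hM k)
  · simp [b.repr_apply_apply, mem_basisBlock.1 hx ⟨j, k⟩ hj]

instance [CompleteSpace E] (i : ι) : (basisBlock b i).HasOrthogonalProjection :=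
  haveI : CompleteSpace (basisBlock b i) := (isClosed_basisBlock i).completeSpace_coe
  inferInstance

theorem starProjection_basisBlock_of_ne [CompleteSpace E] {i j : ι} (hij : i ≠ j) {x : E}
    (hx : x ∈ basisBlock b i) : (basisBlock b j).starProjection x = 0 :=
  (basisBlock b j).starProjection_apply_eq_zero_iff.2 <| (Submodule.mem_orthogonal _ _).2
    fun _ hy => inner_eq_zero_of_mem_basisBlock hij.symm hy hx

theorem sum_starProjection_basisBlock [Fintype ι] [CompleteSpace E] (x : E) :
    ∑ i, (basisBlock b i).starProjection x = x := by
  classical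
  refine b.repr.injective (Subtype.ext (funext fun s => ?_))
  rw [b.repr_apply_apply, b.repr_apply_apply, inner_sum, Finset.sum_eq_single s.1]
  · rw [← Submodule.inner_starProjection_left_eq_right,
      Submodule.starProjection_eq_self_iff.2 (hilbertBasis_mem_basisBlock s)]
  · intro i _ hi
    rw [← Submodule.inner_starProjection_left_eq_right,
      starProjection_basisBlock_of_ne hi.symm (hilbertBasis_mem_basisBlock s), inner_zero_left]
  · simp

/-- The operator that acts as `M i` on the `i`-th block of a Hilbert basis. -/
def blockOperator [Fintype ι] [CompleteSpace E] (b : HilbertBasis (Σ i, κ i) ℝ E)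
    (M : ι → E →L[ℝ] E) : E →L[ℝ] E :=
  ∑ i, M i ∘L (basisBlock b i).starProjection

theorem blockOperator_apply [Fintype ι] [CompleteSpace E] (M : ι → E →L[ℝ] E) (x : E) :
    blockOperator b M x = ∑ i, M i ((basisBlock b i).starProjection x) := by
  simp [blockOperator]

theorem blockOperator_apply_of_mem [Fintype ι] [CompleteSpace E] (M : ι → E →L[ℝ] E) {i : ι}
    {x : E} (hx : x ∈ basisBlock b i) : blockOperator b M x = M i x := by
  rw [blockOperator_apply, Finset.sum_eq_single i]
  · rw [Submodule.starProjection_eq_self_iff.2 hx]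
  · intro j _ hj
    rw [starProjection_basisBlock_of_ne hj.symm hx, map_zero]
  · simp

end Block

section Assembly

variable {ι E : Type} {κ : ι → Type} [NormedAddCommGroup E] [InnerProductSpace ℝ E]
  {b : HilbertBasis (Σ i, κ i) ℝ E} {V : ι → Submodule ℝ E} {M : ι → E ≃L[ℝ] E}

variable [Fintype ι] [CompleteSpace E]

theorem exists_norm_le_mul_norm_blockOperator (hclosed : ∀ i, IsClosed (V i : Set E))
    (hM : ∀ i k, M i (b ⟨i, k⟩) ∈ V i) {K : ℝ}
    (hK : ∀ g : ι → E, (∀ i, g i ∈ V i) → ∀ i, ‖g i‖ ≤ K * ‖∑ j, g j‖) :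
    ∃ C : ℝ, ∀ x, ‖x‖ ≤ C * ‖blockOperator b (fun i => (M i : E →L[ℝ] E)) x‖ := by
  refine ⟨∑ i, ‖((M i).symm : E →L[ℝ] E)‖ * K, fun x => ?_⟩
  let P (i : ι) : E →L[ℝ] E := (basisBlock b i).starProjection
  have hV (i : ι) : M i (P i x) ∈ V i :=
    map_mem_of_mem_basisBlock (M := (M i : E →L[ℝ] E)) (hclosed i) (hM i)
      (Submodule.starProjection_apply_mem _ x)
  calc ‖x‖ = ‖∑ i, (M i).symm (M i (P i x))‖ := by
        simp only [ContinuousLinearEquiv.symm_apply_apply, P, sum_starProjection_basisBlock]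
    _ ≤ ∑ i, ‖((M i).symm : E →L[ℝ] E)‖ * ‖M i (P i x)‖ :=
        norm_sum_le_of_le _ fun i _ => ((M i).symm : E →L[ℝ] E).le_opNorm _
    _ ≤ ∑ i, ‖((M i).symm : E →L[ℝ] E)‖ * (K * ‖∑ j, M j (P j x)‖) := by
        gcongr with i
        exact hK _ hV i
    _ = _ := by
        simp only [blockOperator_apply, Finset.sum_mul, mul_assoc]
        rfl

theorem isRieszBasis_of_blocks (hclosed : ∀ i, IsClosed (V i : Set E))
    (hdense : (⨆ i, V i).topologicalClosure = ⊤) {K : ℝ}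
    (hK : ∀ g : ι → E, (∀ i, g i ∈ V i) → ∀ i, ‖g i‖ ≤ K * ‖∑ j, g j‖)
    (hM : ∀ i k, M i (b ⟨i, k⟩) ∈ V i)
    (hM' : ∀ i, ∀ v ∈ V i, (M i).symm v ∈ basisBlock b i) :
    IsRieszBasis fun s => M s.1 (b s) := by
  let T : E →L[ℝ] E := blockOperator b fun i => (M i : E →L[ℝ] E)
  obtain ⟨C, hC⟩ := exists_norm_le_mul_norm_blockOperator hclosed hM hK
  have hT {i : ι} {x : E} (hx : x ∈ basisBlock b i) : T x = M i x :=
    blockOperator_apply_of_mem _ hx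
  have hanti : AntilipschitzWith C.toNNReal T := T.antilipschitz_of_bound fun x =>
    (hC x).trans (by gcongr; exact Real.le_coe_toNNReal C)
  have hrange : T.range = ⊤ := by
    refine top_le_iff.1 (hdense ▸ Submodule.topologicalClosure_minimal _ (iSup_le fun i v hv => ?_)
      (hanti.isClosed_range T.uniformContinuous))
    exact ⟨(M i).symm v, (hT (hM' i v hv)).trans ((M i).apply_symm_apply v)⟩
  have hker : T.ker = ⊥ := LinearMap.ker_eq_bot.2 hanti.injective
  exact ⟨b, .ofBijective T hker hrange, fun s => (hT (hilbertBasis_mem_basisBlock s)).symm⟩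

end Assembly

section Legendre

open Polynomial

theorem legendre_add_two (n : ℕ) :
    ((n : ℝ[X]) + 2) * legendre (n + 2) =
      (2 * (n : ℝ[X]) + 3) * X * legendre (n + 1) - ((n : ℝ[X]) + 1) * legendre n := by
  have hinv : ((n : ℝ[X]) + 2) * C (1 / ((n : ℝ) + 2)) = 1 := by
    have hC : ((n : ℝ[X]) + 2) = C ((n : ℝ) + 2) := by simp [map_ofNat]
    rw [hC, ← C_mul, mul_one_div_cancel (by positivity), C_1]
  rw [legendre, ← mul_assoc, hinv, one_mul]
  simp [map_ofNat]

theorem derivative_legendre_succ_and (n : ℕ) :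
    derivative (legendre (n + 1)) = X * derivative (legendre n) + ((n : ℝ[X]) + 1) * legendre n ∧
    X * derivative (legendre (n + 1)) - derivative (legendre n)
      = ((n : ℝ[X]) + 1) * legendre (n + 1) := by
  induction n with
  | zero => simp [legendre]
  | succ n ih =>
    obtain ⟨hsucc, hpred⟩ := ih
    have hrec := legendre_add_two n
    have hderiv := congrArg derivative hrec
    simp only [derivative_mul, derivative_add, derivative_sub, derivative_natCast, derivative_X,
      derivative_ofNat, derivative_one] at hderiv
    have hne : ((n : ℝ[X]) + 2) ≠ 0 := by exact_mod_cast (n + 1).succ_ne_zero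
    have hsucc' : derivative (legendre (n + 2)) = X * derivative (legendre (n + 1))
        + ((n : ℝ[X]) + 2) * legendre (n + 1) :=
      mul_left_cancel₀ hne (by linear_combination hderiv + ((n : ℝ[X]) + 1) * hpred)
    push_cast
    exact ⟨by linear_combination hsucc', by
      linear_combination X * hsucc' - hrec + X * hpred - hsucc⟩

theorem one_sub_X_sq_mul_derivative_legendre (n : ℕ) :
    (1 - X ^ 2) * derivative (legendre (n + 1))
      = ((n : ℝ[X]) + 1) * (legendre n - X * legendre (n + 1)) := by
  obtain ⟨hsucc, hpred⟩ := derivative_legendre_succ_and n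
  linear_combination hsucc - X * hpred

theorem legendre_differential_equation (n : ℕ) :
    derivative ((1 - X ^ 2) * derivative (legendre n))
      = -((n : ℝ[X]) * ((n : ℝ[X]) + 1)) * legendre n := by
  cases n with
  | zero => simp [legendre]
  | succ n =>
    rw [one_sub_X_sq_mul_derivative_legendre]
    simp only [derivative_mul, derivative_add, derivative_sub, derivative_natCast, derivative_X,
      derivative_one]
    push_cast
    linear_combination -((n : ℝ[X]) + 1) * (derivative_legendre_succ_and n).2

/-- Integration of polynomials over `[-1,1]`, as a linear functional. -/
def polyIntegral : ℝ[X] →ₗ[ℝ] ℝ where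
  toFun q := ∫ t in (-1 : ℝ)..1, q.eval t
  map_add' q r := by
    simp only [eval_add]
    exact intervalIntegral.integral_add (q.continuous.intervalIntegrable _ _)
      (r.continuous.intervalIntegrable _ _)
  map_smul' c q := by simp [eval_smul]

theorem polyIntegral_apply (q : ℝ[X]) : polyIntegral q = ∫ t in (-1 : ℝ)..1, q.eval t := rfl

theorem polyIntegral_natCast_mul (k : ℕ) (q : ℝ[X]) :
    polyIntegral (k * q) = k * polyIntegral q := by
  simp only [← nsmul_eq_mul, map_nsmul]

theorem polyIntegral_derivative (q : ℝ[X]) :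
    polyIntegral (derivative q) = q.eval 1 - q.eval (-1) :=
  intervalIntegral.integral_eq_sub_of_hasDerivAt (fun t _ => q.hasDerivAt t)
    ((derivative q).continuous.intervalIntegrable _ _)

theorem polyIntegral_legendre_mul_of_ne {m n : ℕ} (hmn : m ≠ n) :
    polyIntegral (legendre m * legendre n) = 0 := by
  have hwronskian : ((n * (n + 1) : ℕ) : ℝ[X]) * (legendre m * legendre n)
      - ((m * (m + 1) : ℕ) : ℝ[X]) * (legendre m * legendre n)
      = derivative ((1 - X ^ 2) * derivative (legendre m) * legendre n
        - (1 - X ^ 2) * derivative (legendre n) * legendre m) := by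
    rw [derivative_sub, derivative_mul (f := (1 - X ^ 2) * derivative (legendre m)),
      derivative_mul (f := (1 - X ^ 2) * derivative (legendre n)),
      legendre_differential_equation, legendre_differential_equation]
    push_cast
    ring
  have hboundary : polyIntegral (derivative ((1 - X ^ 2) * derivative (legendre m) * legendre n
      - (1 - X ^ 2) * derivative (legendre n) * legendre m)) = 0 := by
    rw [polyIntegral_derivative]
    simp
  have h : ((n : ℝ) - m) * (n + m + 1) * polyIntegral (legendre m * legendre n) = 0 := by
    rw [← hboundary, ← hwronskian, map_sub, polyIntegral_natCast_mul, polyIntegral_natCast_mul]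
    push_cast
    ring
  refine (mul_eq_zero.1 h).resolve_left (mul_ne_zero ?_ (by positivity))
  exact sub_ne_zero.2 (Nat.cast_injective.ne hmn.symm)

theorem polyIntegral_legendre_mul_self (n : ℕ) :
    polyIntegral (legendre n * legendre n) = 2 / (2 * (n : ℝ) + 1) := by
  induction n using Nat.twoStepInduction with
  | zero => norm_num [polyIntegral_apply, legendre]
  | one => norm_num [polyIntegral_apply, legendre, ← pow_two]
  | more n _ ih =>
    have hrec : ((2 * n + 5 : ℕ) : ℝ[X]) * (((n + 2 : ℕ) : ℝ[X]) *
          (legendre (n + 2) * legendre (n + 2)) + ((n + 1 : ℕ) : ℝ[X]) *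
          (legendre n * legendre (n + 2)))
        = ((2 * n + 3 : ℕ) : ℝ[X]) * (((n + 3 : ℕ) : ℝ[X]) *
          (legendre (n + 3) * legendre (n + 1)) + ((n + 2 : ℕ) : ℝ[X]) *
          (legendre (n + 1) * legendre (n + 1))) := by
      have h0 := legendre_add_two n
      have h1 := legendre_add_two (n + 1)
      push_cast at h1 ⊢
      linear_combination (2 * (n : ℝ[X]) + 5) * legendre (n + 2) * h0
        - (2 * (n : ℝ[X]) + 3) * legendre (n + 1) * h1
    have h := congrArg polyIntegral hrec
    rw [polyIntegral_natCast_mul, polyIntegral_natCast_mul, map_add, map_add,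
      polyIntegral_natCast_mul, polyIntegral_natCast_mul, polyIntegral_natCast_mul,
      polyIntegral_natCast_mul, ih,
      polyIntegral_legendre_mul_of_ne (m := n) (n := n + 2) (by omega),
      polyIntegral_legendre_mul_of_ne (m := n + 3) (n := n + 1) (by omega)] at h
    push_cast at h ⊢
    field_simp at h ⊢
    have hpos : (0 : ℝ) < (n + 2) * (2 * (n + 1) + 1) := by positivity
    refine mul_left_cancel₀ hpos.ne' ?_
    linear_combination h

theorem degree_legendre (n : ℕ) : (legendre n).degree = n := by
  induction n using Nat.twoStepInduction with
  | zero => simp [legendre]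
  | one => simp [legendre]
  | more n ih ih' =>
    have hlead : (C (2 * (n : ℝ) + 3) * X * legendre (n + 1)).degree
        = ((n + 2 : ℕ) : WithBot ℕ) := by
      rw [degree_mul, degree_mul, ih', degree_C (by positivity), degree_X]
      norm_cast
      ring
    have hlow : (C ((n : ℝ) + 1) * legendre n).degree = n := by
      rw [degree_mul, ih, degree_C (by positivity), zero_add]
    rw [legendre, degree_mul, degree_C (by positivity), zero_add,
      degree_sub_eq_left_of_degree_lt, hlead]
    rw [hlead, hlow]
    exact_mod_cast (by omega : n < n + 2)

theorem integral_normLegendre_mul (m n : ℕ) :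
    ∫ t in Set.Icc (-1 : ℝ) 1, normLegendre m t * normLegendre n t = if m = n then 1 else 0 := by
  have hpoly : ∫ t in Set.Icc (-1 : ℝ) 1, normLegendre m t * normLegendre n t
      = √((2 * m + 1) / 2) * √((2 * n + 1) / 2) * polyIntegral (legendre m * legendre n) := by
    rw [integral_Icc_eq_integral_Ioc, ← intervalIntegral.integral_of_le (by norm_num),
      polyIntegral_apply, ← intervalIntegral.integral_const_mul]
    simp only [normLegendre, eval_mul, mul_mul_mul_comm]
  rw [hpoly]
  split_ifs with h
  · rw [h, Real.mul_self_sqrt (by positivity), polyIntegral_legendre_mul_self]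
    field_simp
  · rw [polyIntegral_legendre_mul_of_ne h, mul_zero]

theorem normLegendre_zero (t : ℝ) : normLegendre 0 t = √(1 / 2) := by
  simp [normLegendre, legendre]

theorem integral_normLegendre_eq_zero {m : ℕ} (hm : m ≠ 0) :
    ∫ t in Set.Icc (-1 : ℝ) 1, normLegendre m t = 0 := by
  have h := integral_normLegendre_mul m 0
  simp only [normLegendre_zero, hm, if_false, integral_mul_const] at h
  exact (mul_eq_zero.1 h).resolve_right (by positivity)

theorem continuous_normLegendre (m : ℕ) : Continuous (normLegendre m) := by
  unfold normLegendre
  fun_prop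

/-- The normalized Legendre polynomials as a polynomial sequence, which makes them a basis of the
polynomials. -/
def normLegendreSeq : Polynomial.Sequence ℝ where
  elems' m := C √((2 * (m : ℝ) + 1) / 2) * legendre m
  degree_eq' m := by rw [degree_mul, degree_C (by positivity), zero_add, degree_legendre]

theorem eval_normLegendreSeq (m : ℕ) (t : ℝ) : (normLegendreSeq m).eval t = normLegendre m t := by
  simp [normLegendreSeq, normLegendre]

end Legendre

section Cube

variable {ι : Type*} [Fintype ι]

/-- Lebesgue measure on the cube `[-1,1]^ι`. -/
def cube (ι : Type*) [Fintype ι] : Measure (ι → ℝ) := volume.restrict (Set.Icc (-1) 1)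

theorem cube_eq_pi (ι : Type*) [Fintype ι] :
    cube ι = Measure.pi fun _ : ι => (volume : Measure ℝ).restrict (Set.Icc (-1) 1) := by
  rw [← Measure.restrict_pi_pi, Set.pi_univ_Icc]
  rfl

theorem ae_mem_cube (ι : Type*) [Fintype ι] : ∀ᵐ x ∂(cube ι), x ∈ Set.Icc (-1 : ι → ℝ) 1 :=
  ae_restrict_mem measurableSet_Icc

instance : IsFiniteMeasure (cube ι) := by
  rw [cube_eq_pi]
  infer_instance

theorem cube_real_univ (ι : Type*) [Fintype ι] :
    (cube ι).real Set.univ = 2 ^ Fintype.card ι := by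
  rw [cube, measureReal_restrict_apply_univ, measureReal_def, Real.volume_Icc_pi_toReal]
  · norm_num
  · intro i
    norm_num

theorem integrable_mul_of_continuous {u g : (ι → ℝ) → ℝ} (hu : Integrable u (cube ι))
    (hg : Continuous g) : Integrable (fun x => u x * g x) (cube ι) := by
  obtain ⟨C, hC⟩ := isCompact_Icc.exists_bound_of_continuousOn (s := Set.Icc (-1) 1) hg.continuousOn
  exact hu.mul_bdd (c := C) hg.aestronglyMeasurable ((ae_mem_cube ι).mono hC)

/-- The tensor product of normalized Legendre polynomials with exponents `k`. -/
def tensor (k : ι → ℕ) (x : ι → ℝ) : ℝ :=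
  ∏ j, normLegendre (k j) (x j)

theorem continuous_tensor (k : ι → ℕ) : Continuous (tensor k) :=
  continuous_finsetProd _ fun j _ => (continuous_normLegendre (k j)).comp (continuous_apply j)

theorem integral_tensor_mul (k l : ι → ℕ) :
    ∫ x, tensor k x * tensor l x ∂(cube ι) = if k = l then 1 else 0 := by
  simp only [tensor, ← Finset.prod_mul_distrib]
  rw [cube_eq_pi,
    integral_fintype_prod_eq_prod fun j t => normLegendre (k j) t * normLegendre (l j) t]
  simp only [integral_normLegendre_mul]
  split_ifs with h
  · simp [h]
  · obtain ⟨j, hj⟩ := Function.ne_iff.1 h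
    exact Finset.prod_eq_zero (Finset.mem_univ j) (if_neg hj)

theorem integral_tensor_eq_zero {k : ι → ℕ} {j : ι} (hj : k j ≠ 0) :
    ∫ x, tensor k x ∂(cube ι) = 0 := by
  simp only [tensor]
  rw [cube_eq_pi, integral_fintype_prod_eq_prod fun j t => normLegendre (k j) t]
  exact Finset.prod_eq_zero (Finset.mem_univ j) (integral_normLegendre_eq_zero hj)

end Cube

section Split

variable {ι : Type*} [DecidableEq ι] (S : Finset ι)

/-- Splitting a point into its coordinates in `S` and those outside `S`, as in the definition of
`marginal`. -/
abbrev splitEquiv : (ι → ℝ) ≃ᵐ ({j // j ∈ S} → ℝ) × ({j // ¬ j ∈ S} → ℝ) :=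
  MeasurableEquiv.piEquivPiSubtypeProd (fun _ => ℝ) (· ∈ S)

variable {S}

theorem restrict_splitEquiv_symm (z : ({j // j ∈ S} → ℝ) × ({j // ¬ j ∈ S} → ℝ)) :
    S.restrict ((splitEquiv S).symm z) = z.1 :=
  congrArg Prod.fst ((splitEquiv S).apply_symm_apply z)

theorem splitEquiv_symm_apply_mem (z : ({j // j ∈ S} → ℝ) × ({j // ¬ j ∈ S} → ℝ))
    (j : {j // j ∈ S}) : (splitEquiv S).symm z j = z.1 j :=
  congrFun (restrict_splitEquiv_symm z) j

theorem splitEquiv_symm_apply_notMem (z : ({j // j ∈ S} → ℝ) × ({j // ¬ j ∈ S} → ℝ))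
    (j : {j // ¬ j ∈ S}) : (splitEquiv S).symm z j = z.2 j :=
  congrFun (congrArg Prod.snd ((splitEquiv S).apply_symm_apply z)) j

theorem splitEquiv_symm_mem_cube {z : ({j // j ∈ S} → ℝ) × ({j // ¬ j ∈ S} → ℝ)}
    (h₁ : z.1 ∈ Set.Icc (-1) 1) (h₂ : z.2 ∈ Set.Icc (-1) 1) :
    (splitEquiv S).symm z ∈ Set.Icc (-1 : ι → ℝ) 1 := by
  rw [← Set.pi_univ_Icc]
  intro j _
  by_cases hj : j ∈ S
  · exact splitEquiv_symm_apply_mem z ⟨j, hj⟩ ▸ ⟨h₁.1 _, h₁.2 _⟩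
  · exact splitEquiv_symm_apply_notMem z ⟨j, hj⟩ ▸ ⟨h₂.1 _, h₂.2 _⟩

variable [Fintype ι]

theorem measurePreserving_splitEquiv_symm (S : Finset ι) :
    MeasurePreserving (splitEquiv S).symm ((cube {j // j ∈ S}).prod (cube {j // ¬ j ∈ S}))
      (cube ι) := by
  simp only [cube_eq_pi]
  convert (measurePreserving_piEquivPiSubtypeProd
    (fun _ : ι => (volume : Measure ℝ).restrict (Set.Icc (-1) 1)) (· ∈ S)).symm

theorem integral_cube_eq_integral_prod (S : Finset ι)
    (F : (ι → ℝ) → ℝ) :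
    ∫ x, F x ∂(cube ι)
      = ∫ z, F ((splitEquiv S).symm z) ∂((cube {j // j ∈ S}).prod (cube {j // ¬ j ∈ S})) :=
  ((measurePreserving_splitEquiv_symm S).integral_comp' F).symm

theorem tensor_splitEquiv_symm (k : ι → ℕ) (z : ({j // j ∈ S} → ℝ) × ({j // ¬ j ∈ S} → ℝ)) :
    tensor k ((splitEquiv S).symm z)
      = tensor (fun j : {j // j ∈ S} => k j) z.1 * tensor (fun j : {j // ¬ j ∈ S} => k j) z.2 := by
  rw [tensor, ← Fintype.prod_subtype_mul_prod_subtype (· ∈ S)]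
  simp only [splitEquiv_symm_apply_mem, splitEquiv_symm_apply_notMem, tensor]
  convert rfl

end Split

theorem integral_tensor_mul_restrict_eq_zero {ι : Type*} [Fintype ι] {S : Finset ι} {k : ι → ℕ}
    {j : ι} (hj : j ∉ S) (hk : k j ≠ 0) (h : ({j // j ∈ S} → ℝ) → ℝ) :
    ∫ x, tensor k x * h (S.restrict x) ∂(cube ι) = 0 := by
  classical
  rw [integral_cube_eq_integral_prod S]
  simp only [tensor_splitEquiv_symm, restrict_splitEquiv_symm, mul_right_comm]
  rw [integral_prod_mul fun a => tensor (fun j : {j // j ∈ S} => k j) a * h a,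
    integral_tensor_eq_zero (ι := {j // ¬ j ∈ S}) (j := ⟨j, hj⟩) hk, mul_zero]

section Completeness

variable {ι : Type*}

theorem exists_mvPolynomial_norm_sub_lt {g : (ι → ℝ) → ℝ} (hg : Continuous g) {ε : ℝ}
    (hε : 0 < ε) :
    ∃ q : MvPolynomial ι ℝ, ∀ x ∈ Set.Icc (-1 : ι → ℝ) 1, ‖q.eval x - g x‖ < ε := by
  let K := Set.Icc (-1 : ι → ℝ) 1
  have : CompactSpace K := isCompact_iff_compactSpace.1 isCompact_Icc
  let coord (j : ι) : C(K, ℝ) := ⟨fun x => x.1 j, (continuous_apply j).comp continuous_subtype_val⟩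
  let A : Subalgebra ℝ C(K, ℝ) := (MvPolynomial.aeval coord).range
  have hA : A.SeparatesPoints := by
    intro x y hxy
    obtain ⟨j, hj⟩ := Function.ne_iff.1 (Subtype.coe_injective.ne hxy)
    exact ⟨coord j, ⟨coord j, ⟨MvPolynomial.X j, by simp⟩, rfl⟩, hj⟩
  obtain ⟨⟨_, q, rfl⟩, hq⟩ := ContinuousMap.exists_mem_subalgebra_near_continuous_of_separatesPoints
    A hA (fun x => g x.1) (hg.comp continuous_subtype_val) ε hε
  have heval (x : K) : MvPolynomial.aeval coord q x = q.eval x.1 := by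
    have halg : (ContinuousMap.evalAlgHom ℝ ℝ x).comp (MvPolynomial.aeval coord)
        = MvPolynomial.aeval x.1 := MvPolynomial.algHom_ext fun j => by simp [coord]
    simpa [MvPolynomial.aeval_eq_eval] using DFunLike.congr_fun halg q
  exact ⟨q, fun x hx => by simpa [heval] using hq ⟨x, hx⟩⟩

variable [Fintype ι] {u : (ι → ℝ) → ℝ}

/-- The moment functional `q ↦ ∫ u q` of an integrable function on the cube. -/
def momentFunctional (hu : Integrable u (cube ι)) : MvPolynomial ι ℝ →ₗ[ℝ] ℝ where
  toFun q := ∫ x, u x * q.eval x ∂(cube ι)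
  map_add' q r := by
    simp only [map_add, mul_add]
    exact integral_add (integrable_mul_of_continuous hu q.continuous_eval)
      (integrable_mul_of_continuous hu r.continuous_eval)
  map_smul' c q := by
    simp only [MvPolynomial.smul_eval, RingHom.id_apply, smul_eq_mul, mul_left_comm,
      integral_const_mul]

theorem momentFunctional_apply (hu : Integrable u (cube ι)) (q : MvPolynomial ι ℝ) :
    momentFunctional hu q = ∫ x, u x * q.eval x ∂(cube ι) := rfl

theorem eval_prod_aeval_X (q : ι → Polynomial ℝ) (x : ι → ℝ) :
    (∏ j, Polynomial.aeval (MvPolynomial.X j : MvPolynomial ι ℝ) (q j)).eval x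
      = ∏ j, (q j).eval (x j) := by
  rw [MvPolynomial.eval_prod]
  refine Finset.prod_congr rfl fun j _ => ?_
  have hcomp : (MvPolynomial.aeval x).comp
      (Polynomial.aeval (MvPolynomial.X j : MvPolynomial ι ℝ)) = Polynomial.aeval (x j) :=
    Polynomial.algHom_ext (by simp)
  simpa [MvPolynomial.aeval_eq_eval] using DFunLike.congr_fun hcomp (q j)

theorem momentFunctional_eq_zero (hu : Integrable u (cube ι))
    (h : ∀ k, ∫ x, u x * tensor k x ∂(cube ι) = 0) : momentFunctional hu = 0 := by
  let Λ : MultilinearMap ℝ (fun _ : ι => Polynomial ℝ) ℝ :=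
    (momentFunctional hu).compMultilinearMap
      ((MultilinearMap.mkPiAlgebra ℝ ι (MvPolynomial ι ℝ)).compLinearMap
        fun j => (Polynomial.aeval (MvPolynomial.X j : MvPolynomial ι ℝ)).toLinearMap)
  have hΛ (q : ι → Polynomial ℝ) :
      Λ q = momentFunctional hu (∏ j, Polynomial.aeval (MvPolynomial.X j) (q j)) := rfl
  have hΛ0 : Λ = 0 := by
    refine Module.Basis.ext_multilinear (fun _ => normLegendreSeq.basis fun i =>
      (Polynomial.leadingCoeff_ne_zero.2 (normLegendreSeq.ne_zero i)).isUnit) fun k => ?_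
    simp only [hΛ, momentFunctional_apply, eval_prod_aeval_X, Polynomial.Sequence.basis_eq_self,
      eval_normLegendreSeq]
    exact h k
  refine (MvPolynomial.basisMonomials ι ℝ).ext fun s => ?_
  have hmonomial : MvPolynomial.monomial s (1 : ℝ)
      = ∏ j, Polynomial.aeval (R := ℝ) (MvPolynomial.X j) (Polynomial.X ^ s j) := by
    rw [MvPolynomial.monomial_eq, Finsupp.prod_fintype _ _ fun _ => pow_zero _]
    simp only [map_one, one_mul, map_pow, Polynomial.aeval_X]
  rw [MvPolynomial.coe_basisMonomials, LinearMap.zero_apply]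
  beta_reduce
  rw [hmonomial, ← hΛ, hΛ0, zero_apply]

theorem integral_mul_continuous_eq_zero (hu : Integrable u (cube ι))
    (h : ∀ k, ∫ x, u x * tensor k x ∂(cube ι) = 0) {g : (ι → ℝ) → ℝ} (hg : Continuous g) :
    ∫ x, u x * g x ∂(cube ι) = 0 := by
  set U := ∫ x, ‖u x‖ ∂(cube ι)
  have : 0 ≤ U := integral_nonneg fun _ => norm_nonneg _
  refine norm_le_zero_iff.1 (le_of_forall_pos_le_add fun ε hε => ?_)
  obtain ⟨q, hq⟩ := exists_mvPolynomial_norm_sub_lt hg (ε := ε / (U + 1)) (by positivity)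
  have hq0 : ∫ x, u x * q.eval x ∂(cube ι) = 0 := by
    rw [← momentFunctional_apply hu, momentFunctional_eq_zero hu h, LinearMap.zero_apply]
  calc ‖∫ x, u x * g x ∂(cube ι)‖ = ‖∫ x, u x * (q.eval x - g x) ∂(cube ι)‖ := by
        simp only [mul_sub]
        rw [integral_sub (integrable_mul_of_continuous hu q.continuous_eval)
          (integrable_mul_of_continuous hu hg), hq0, zero_sub, norm_neg]
    _ ≤ ∫ x, ‖u x‖ * (ε / (U + 1)) ∂(cube ι) := by
        refine norm_integral_le_of_norm_le (hu.norm.mul_const _) ?_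
        filter_upwards [ae_mem_cube ι] with x hx
        rw [norm_mul]
        gcongr
        exact (hq x hx).le
    _ = U / (U + 1) * ε := by rw [integral_mul_const, mul_div_left_comm, mul_comm]
    _ ≤ 0 + ε := by
        rw [zero_add]
        exact mul_le_of_le_one_left hε.le (div_le_one_of_le₀ (by linarith) (by positivity))

theorem ae_eq_zero_of_integral_mul_tensor_eq_zero (hu : Integrable u (cube ι))
    (h : ∀ k, ∫ x, u x * tensor k x ∂(cube ι) = 0) : ∀ᵐ x ∂(cube ι), u x = 0 := by
  refine ae_eq_zero_of_integral_contDiff_smul_eq_zero hu.locallyIntegrable fun g hg _ => ?_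
  simpa only [smul_eq_mul, mul_comm] using integral_mul_continuous_eq_zero hu h hg.continuous

end Completeness

section Weight

variable {ι : Type*} {w v : (ι → ℝ) → ℝ}

/-- A bounded weight on the cube `[-1,1]^ι`: a measurable function that lies between two positive
constants there. Its values outside the cube are irrelevant. -/
structure IsBoundedWeight (w : (ι → ℝ) → ℝ) : Prop where
  measurable : Measurable w
  exists_bounds : ∃ a b : ℝ, 0 < a ∧ ∀ x ∈ Set.Icc (-1 : ι → ℝ) 1, a ≤ w x ∧ w x ≤ b

namespace IsBoundedWeight

theorem pos (hw : IsBoundedWeight w) {x : ι → ℝ} (hx : x ∈ Set.Icc (-1) 1) : 0 < w x := by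
  obtain ⟨a, b, ha, hab⟩ := hw.exists_bounds
  exact ha.trans_le (hab x hx).1

theorem exists_norm_le (hw : IsBoundedWeight w) :
    ∃ C, ∀ x ∈ Set.Icc (-1 : ι → ℝ) 1, ‖w x‖ ≤ C := by
  obtain ⟨a, b, -, hab⟩ := hw.exists_bounds
  refine ⟨b, fun x hx => ?_⟩
  rw [Real.norm_of_nonneg (hw.pos hx).le]
  exact (hab x hx).2

theorem mul (hw : IsBoundedWeight w) (hv : IsBoundedWeight v) :
    IsBoundedWeight fun x => w x * v x := by
  obtain ⟨a, b, ha, hab⟩ := hw.exists_bounds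
  obtain ⟨c, d, hc, hcd⟩ := hv.exists_bounds
  refine ⟨hw.measurable.mul hv.measurable, a * c, b * d, mul_pos ha hc, fun x hx => ⟨?_, ?_⟩⟩
  · exact mul_le_mul (hab x hx).1 (hcd x hx).1 hc.le (hw.pos hx).le
  · exact mul_le_mul (hab x hx).2 (hcd x hx).2 (hv.pos hx).le ((hw.pos hx).le.trans (hab x hx).2)

theorem inv (hw : IsBoundedWeight w) : IsBoundedWeight fun x => (w x)⁻¹ := by
  obtain ⟨a, b, ha, hab⟩ := hw.exists_bounds
  refine ⟨hw.measurable.inv, (max a b)⁻¹, a⁻¹, by positivity, fun x hx => ⟨?_, ?_⟩⟩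
  · exact inv_anti₀ (hw.pos hx) ((hab x hx).2.trans (le_max_right a b))
  · exact inv_anti₀ ha (hab x hx).1

theorem sqrt (hw : IsBoundedWeight w) : IsBoundedWeight fun x => √(w x) := by
  obtain ⟨a, b, ha, hab⟩ := hw.exists_bounds
  exact ⟨hw.measurable.sqrt, √a, √b, Real.sqrt_pos.2 ha, fun x hx =>
    ⟨Real.sqrt_le_sqrt (hab x hx).1, Real.sqrt_le_sqrt (hab x hx).2⟩⟩

theorem integrable_mul [Fintype ι] (hw : IsBoundedWeight w) {u : (ι → ℝ) → ℝ}
    (hu : Integrable u (cube ι)) : Integrable (fun x => u x * w x) (cube ι) := by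
  obtain ⟨C, hC⟩ := hw.exists_norm_le
  exact hu.mul_bdd (c := C) hw.measurable.aestronglyMeasurable ((ae_mem_cube ι).mono hC)

theorem integrable [Fintype ι] (hw : IsBoundedWeight w) : Integrable w (cube ι) := by
  simpa only [one_mul] using hw.integrable_mul (integrable_const 1)

end IsBoundedWeight

theorem mul_two_pow_card_le_integral_cube [Fintype ι] {c : ℝ} (hw : Integrable w (cube ι))
    (hc : ∀ x ∈ Set.Icc (-1 : ι → ℝ) 1, c ≤ w x) :
    c * 2 ^ Fintype.card ι ≤ ∫ x, w x ∂(cube ι) := by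
  rw [← cube_real_univ ι, mul_comm, ← smul_eq_mul, ← integral_const]
  exact integral_mono_ae (integrable_const c) hw ((ae_mem_cube ι).mono hc)

end Weight

section Marginal

variable {p : ℕ} {f : (Fin p → ℝ) → ℝ} {S : Finset (Fin p)}

theorem card_notMem (S : Finset (Fin p)) : Fintype.card {j // ¬ j ∈ S} = p - S.card := by
  rw [Fintype.card_subtype_compl, Fintype.card_fin, Fintype.card_coe]

theorem restrict_mem_cube {x : Fin p → ℝ} (hx : x ∈ Set.Icc (-1) 1) :
    S.restrict x ∈ Set.Icc (-1 : {j // j ∈ S} → ℝ) 1 :=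
  ⟨fun j => hx.1 j, fun j => hx.2 j⟩

theorem marginal_eq_integral_cube (a : {j // j ∈ S} → ℝ) :
    marginal f S a = ∫ y, f ((splitEquiv S).symm (a, y)) ∂(cube {j // ¬ j ∈ S}) := rfl

theorem measurable_marginal (hf : Measurable f) : Measurable (marginal f S) := by
  have : StronglyMeasurable (fun z => f ((splitEquiv S).symm z)) :=
    (hf.comp (splitEquiv S).symm.measurable).stronglyMeasurable
  exact this.integral_prod_right.measurable

theorem IsBoundedWeight.comp_splitEquiv_symm (hf : IsBoundedWeight f) {a : {j // j ∈ S} → ℝ}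
    (ha : a ∈ Set.Icc (-1) 1) : IsBoundedWeight fun y => f ((splitEquiv S).symm (a, y)) where
  measurable := hf.measurable.comp ((splitEquiv S).symm.measurable.comp measurable_prodMk_left)
  exists_bounds := by
    obtain ⟨c, d, hc, hcd⟩ := hf.exists_bounds
    exact ⟨c, d, hc, fun y hy => hcd _ (splitEquiv_symm_mem_cube ha hy)⟩

theorem IsBoundedWeight.marginal_restrict (hf : IsBoundedWeight f) (S : Finset (Fin p)) :
    IsBoundedWeight fun x => marginal f S (S.restrict x) := by
  obtain ⟨c, d, hc, hcd⟩ := hf.exists_bounds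
  refine ⟨(measurable_marginal hf.measurable).comp (Finset.measurable_restrict S),
    c * 2 ^ (p - S.card), d * 2 ^ (p - S.card), by positivity, fun x hx => ?_⟩
  have ha := restrict_mem_cube (S := S) hx
  have hint := (hf.comp_splitEquiv_symm ha).integrable
  have hle (y) (hy : y ∈ Set.Icc (-1 : {j // ¬ j ∈ S} → ℝ) 1) :=
    hcd _ (splitEquiv_symm_mem_cube (z := (S.restrict x, y)) ha hy)
  rw [marginal_eq_integral_cube, ← card_notMem]
  refine ⟨mul_two_pow_card_le_integral_cube hint fun y hy => (hle y hy).1, ?_⟩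
  rw [← neg_le_neg_iff, ← neg_mul, ← integral_neg]
  exact mul_two_pow_card_le_integral_cube hint.neg fun y hy => neg_le_neg (hle y hy).2

theorem two_pow_mul_integral_restrict_mul (hf : IsBoundedWeight f)
    {h : ({j // j ∈ S} → ℝ) → ℝ} (hh : Integrable (fun x => h (S.restrict x)) (cube (Fin p))) :
    2 ^ (p - S.card) * ∫ x, h (S.restrict x) * f x ∂(cube (Fin p))
      = ∫ x, h (S.restrict x) * marginal f S (S.restrict x) ∂(cube (Fin p)) := by
  have hint : Integrable (fun z => h z.1 * f ((splitEquiv S).symm z))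
      ((cube {j // j ∈ S}).prod (cube {j // ¬ j ∈ S})) := by
    simpa only [Function.comp_def, restrict_splitEquiv_symm] using
      (measurePreserving_splitEquiv_symm S).integrable_comp_of_integrable (hf.integrable_mul hh)
  rw [integral_cube_eq_integral_prod S, integral_cube_eq_integral_prod S]
  simp only [restrict_splitEquiv_symm]
  rw [integral_prod _ hint, integral_fun_fst fun a => h a * marginal f S a, cube_real_univ,
    card_notMem, smul_eq_mul]
  simp only [integral_const_mul, marginal_eq_integral_cube]

end Marginal

section Law

variable {p : ℕ} {f : (Fin p → ℝ) → ℝ}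

theorem ae_muF_of_ae_cube {P : (Fin p → ℝ) → Prop} (h : ∀ᵐ x ∂(cube (Fin p)), P x) :
    ∀ᵐ x ∂(muF f), P x :=
  (withDensity_absolutelyContinuous _ _).ae_le h

theorem ae_muF_mem_cube (f : (Fin p → ℝ) → ℝ) :
    ∀ᵐ x ∂(muF f), x ∈ Set.Icc (-1 : Fin p → ℝ) 1 :=
  ae_muF_of_ae_cube (ae_mem_cube (Fin p))

namespace IsBoundedWeight

theorem ae_cube_of_ae_muF (hf : IsBoundedWeight f) {P : (Fin p → ℝ) → Prop}
    (h : ∀ᵐ x ∂(muF f), P x) : ∀ᵐ x ∂(cube (Fin p)), P x := by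
  refine (withDensity_absolutelyContinuous' (μ := cube (Fin p))
    hf.measurable.ennreal_ofReal.aemeasurable ?_).ae_le h
  filter_upwards [ae_mem_cube (Fin p)] with x hx
  simpa using hf.pos hx

theorem integral_muF (hf : IsBoundedWeight f) (g : (Fin p → ℝ) → ℝ) :
    ∫ x, g x ∂(muF f) = ∫ x, g x * f x ∂(cube (Fin p)) := by
  rw [muF, integral_withDensity_eq_integral_toReal_smul hf.measurable.ennreal_ofReal (by simp)]
  refine integral_congr_ae ?_
  filter_upwards [ae_mem_cube (Fin p)] with x hx
  rw [ENNReal.toReal_ofReal (hf.pos hx).le, smul_eq_mul, mul_comm]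

theorem isFiniteMeasure_muF (hf : IsBoundedWeight f) : IsFiniteMeasure (muF f) :=
  isFiniteMeasure_withDensity_ofReal (μ := cube (Fin p)) hf.integrable.2

theorem integrable_cube (hf : IsBoundedWeight f) {g : (Fin p → ℝ) → ℝ}
    (hg : Integrable g (muF f)) : Integrable g (cube (Fin p)) := by
  rw [muF, integrable_withDensity_iff hf.measurable.ennreal_ofReal (by simp)] at hg
  refine (hf.inv.integrable_mul hg).congr ?_
  filter_upwards [ae_mem_cube (Fin p)] with x hx
  rw [ENNReal.toReal_ofReal (hf.pos hx).le, mul_inv_cancel_right₀ (hf.pos hx).ne']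

theorem memLp_of_continuous (hf : IsBoundedWeight f) {g : (Fin p → ℝ) → ℝ} (hg : Continuous g) :
    MemLp g 2 (muF f) := by
  have := hf.isFiniteMeasure_muF
  obtain ⟨C, hC⟩ := isCompact_Icc.exists_bound_of_continuousOn (s := Set.Icc (-1) 1) hg.continuousOn
  exact .of_bound hg.aestronglyMeasurable C ((ae_muF_mem_cube f).mono hC)

theorem integrable_coeFn (hf : IsBoundedWeight f) (g : L2 f) : Integrable g (cube (Fin p)) :=
  have := hf.isFiniteMeasure_muF
  hf.integrable_cube ((Lp.memLp g).integrable one_le_two)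

theorem integrable_coeFn_mul (hf : IsBoundedWeight f) (g h : L2 f) :
    Integrable (fun x => g x * h x) (cube (Fin p)) :=
  hf.integrable_cube ((Lp.memLp g).integrable_mul (Lp.memLp h))

end IsBoundedWeight

theorem inner_eq_integral_muF (g h : L2 f) : inner ℝ g h = ∫ x, g x * h x ∂(muF f) := by
  simp [L2.inner_def, mul_comm]

theorem IsBoundedWeight.inner_eq_integral_cube (hf : IsBoundedWeight f) {g h : L2 f}
    {u v : (Fin p → ℝ) → ℝ} (hg : g =ᵐ[muF f] u) (hh : h =ᵐ[muF f] v) :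
    inner ℝ g h = ∫ x, u x * v x * f x ∂(cube (Fin p)) := by
  rw [inner_eq_integral_muF, ← hf.integral_muF]
  exact integral_congr_ae (hg.mul hh)

end Law

section Multiplication

variable {p : ℕ} {w v : (Fin p → ℝ) → ℝ}

namespace IsBoundedWeight

theorem memLp_top (hw : IsBoundedWeight w) (f : (Fin p → ℝ) → ℝ) : MemLp w ⊤ (muF f) := by
  obtain ⟨C, hC⟩ := hw.exists_norm_le
  exact memLp_top_of_bound hw.measurable.aestronglyMeasurable C ((ae_muF_mem_cube f).mono hC)

/-- Multiplication by a bounded weight, as an operator on `L²`. -/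
def mulCLM (hw : IsBoundedWeight w) (f : (Fin p → ℝ) → ℝ) : L2 f →L[ℝ] L2 f :=
  (ContinuousLinearMap.mul ℝ ℝ).holderL (muF f) ⊤ 2 2 ((hw.memLp_top f).toLp w)

variable {f : (Fin p → ℝ) → ℝ}

theorem coeFn_mulCLM (hw : IsBoundedWeight w) (g : L2 f) :
    hw.mulCLM f g =ᵐ[muF f] fun x => w x * g x := by
  filter_upwards [(ContinuousLinearMap.mul ℝ ℝ).coeFn_holder (r := 2) ((hw.memLp_top f).toLp w) g,
    (hw.memLp_top f).coeFn_toLp] with x hx hwx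
  rwa [hwx] at hx

theorem mulCLM_mulCLM_of_mul_eq_one (hw : IsBoundedWeight w) (hv : IsBoundedWeight v)
    (h : ∀ x ∈ Set.Icc (-1 : Fin p → ℝ) 1, w x * v x = 1) (g : L2 f) :
    hw.mulCLM f (hv.mulCLM f g) = g := by
  refine Lp.ext ?_
  filter_upwards [hw.coeFn_mulCLM (hv.mulCLM f g), hv.coeFn_mulCLM g, ae_muF_mem_cube f]
    with x hwx hvx hx
  rw [hwx, hvx, ← mul_assoc, h x hx, one_mul]

/-- Multiplication by a bounded weight, as an automorphism of `L²`. -/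
def mulEquiv (hw : IsBoundedWeight w) (f : (Fin p → ℝ) → ℝ) : L2 f ≃L[ℝ] L2 f :=
  .equivOfInverse (hw.mulCLM f) (hw.inv.mulCLM f)
    (mulCLM_mulCLM_of_mul_eq_one hw.inv hw fun _ hx => inv_mul_cancel₀ (hw.pos hx).ne')
    (mulCLM_mulCLM_of_mul_eq_one hw hw.inv fun _ hx => mul_inv_cancel₀ (hw.pos hx).ne')

theorem coeFn_mulEquiv (hw : IsBoundedWeight w) (g : L2 f) :
    hw.mulEquiv f g =ᵐ[muF f] fun x => w x * g x :=
  hw.coeFn_mulCLM g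

theorem coeFn_mulEquiv_symm (hw : IsBoundedWeight w) (g : L2 f) :
    (hw.mulEquiv f).symm g =ᵐ[muF f] fun x => (w x)⁻¹ * g x :=
  hw.inv.coeFn_mulCLM g

theorem exists_mul_norm_sq_le_inner_mulCLM (hw : IsBoundedWeight w) :
    ∃ c > 0, ∀ g : L2 f, c * ‖g‖ ^ 2 ≤ inner ℝ g (hw.mulCLM f g) := by
  obtain ⟨a, b, ha, hab⟩ := hw.exists_bounds
  refine ⟨a, ha, fun g => ?_⟩
  rw [← real_inner_self_eq_norm_sq, inner_eq_integral_muF, inner_eq_integral_muF,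
    ← integral_const_mul]
  have hint (h : L2 f) : Integrable (fun x => g x * h x) (muF f) :=
    (Lp.memLp g).integrable_mul (Lp.memLp h)
  refine integral_mono_ae ((hint g).const_mul a) (hint _) ?_
  filter_upwards [hw.coeFn_mulCLM g, ae_muF_mem_cube f] with x hwx hx
  calc a * (g x * g x) ≤ w x * (g x * g x) :=
        mul_le_mul_of_nonneg_right (hab x hx).1 (mul_self_nonneg _)
    _ = g x * hw.mulCLM f g x := by rw [hwx, mul_left_comm]

end IsBoundedWeight

end Multiplication

section FunctionsOfFewerVariables

variable {p : ℕ} {f : (Fin p → ℝ) → ℝ} {S T : Finset (Fin p)}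

theorem mem_L2S_iff_aestronglyMeasurable {g : L2 f} :
    g ∈ L2S f S ↔ AEStronglyMeasurable[MeasurableSpace.comap
      (S.restrict (π := fun _ : Fin p => ℝ)) MeasurableSpace.pi] g (muF f) := by
  constructor
  · rintro ⟨h, hm, hh⟩
    exact ⟨fun x => h (S.restrict x), (hm.comp
      (comap_measurable (S.restrict (π := fun _ : Fin p => ℝ)))).stronglyMeasurable, hh⟩
  · rintro ⟨u, hu, hg⟩
    obtain ⟨h, hm, rfl⟩ := hu.exists_eq_measurable_comp
    exact ⟨h, hm.measurable, hg⟩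

theorem isClosed_L2S (f : (Fin p → ℝ) → ℝ) (S : Finset (Fin p)) :
    IsClosed (L2S f S : Set (L2 f)) := by
  convert isClosed_aestronglyMeasurable (F := ℝ) (p := 2) (μ := muF f)
    (Finset.measurable_restrict (X := fun _ : Fin p => ℝ) S).comap_le using 1
  exact Set.ext fun _ => mem_L2S_iff_aestronglyMeasurable

theorem monotone_L2S (f : (Fin p → ℝ) → ℝ) : Monotone (L2S f) := by
  rintro T S hTS g ⟨h, hm, hg⟩
  exact ⟨fun a => h fun j => a ⟨j, hTS j.2⟩,
    hm.comp (measurable_pi_lambda _ fun j => measurable_pi_apply _), hg⟩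

theorem L2S_univ (f : (Fin p → ℝ) → ℝ) : L2S f Finset.univ = ⊤ := by
  refine eq_top_iff.2 fun g _ => ⟨fun a => g fun j => a ⟨j, Finset.mem_univ j⟩, ?_, ?_⟩
  · exact (Lp.stronglyMeasurable g).measurable.comp
      (measurable_pi_lambda _ fun j => measurable_pi_apply _)
  · exact .of_forall fun _ => rfl

theorem iSup_hierarchicalPart_L2S (f : (Fin p → ℝ) → ℝ) :
    (⨆ S, hierarchicalPart (L2S f) S).topologicalClosure = ⊤ := by
  rw [← top_le_iff, ← L2S_univ f]
  exact le_topologicalClosure_iSup_hierarchicalPart (monotone_L2S f) (isClosed_L2S f) _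

theorem feasible_iff {g : Finset (Fin p) → L2 f} :
    Feasible f g ↔ ∀ S, g S ∈ hierarchicalPart (L2S f) S := by
  simp only [Feasible, mem_hierarchicalPart, inner_eq_integral_muF]
  exact ⟨fun h S => ⟨h.1 S, fun T => h.2 T S⟩, fun h => ⟨fun S => (h S).1, fun T S => (h S).2 T⟩⟩

theorem two_pow_mul_inner_of_mem_L2S (hf : IsBoundedWeight f) {g h : L2 f}
    (hg : g ∈ L2S f S) (hh : h ∈ L2S f S) :
    2 ^ (p - S.card) * inner ℝ g h
      = ∫ x, g x * h x * marginal f S (S.restrict x) ∂(cube (Fin p)) := by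
  obtain ⟨u, -, hu⟩ := hg
  obtain ⟨v, -, hv⟩ := hh
  have hae : ∀ᵐ x ∂(cube (Fin p)), g x * h x = u (S.restrict x) * v (S.restrict x) :=
    hf.ae_cube_of_ae_muF (by filter_upwards [hu, hv] with x hux hvx; rw [hux, hvx])
  rw [hf.inner_eq_integral_cube hu hv, two_pow_mul_integral_restrict_mul hf
    (h := fun a => u a * v a) ((hf.integrable_coeFn_mul g h).congr hae)]
  refine integral_congr_ae ?_
  filter_upwards [hae] with x hx
  rw [hx]

end FunctionsOfFewerVariables

section LegendreBasis

variable {p : ℕ} {f : (Fin p → ℝ) → ℝ} {S : Finset (Fin p)} {i : Idx p}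

/-- The exponents of the tensor product with index `(S, m_S)`: `m_j` for `j ∈ S`, and `0` for the
other coordinates. -/
def Idx.degree (i : Idx p) (j : Fin p) : ℕ :=
  if h : j ∈ i.1 then i.2 ⟨j, h⟩ else 0

theorem Idx.degree_ne_zero_iff (i : Idx p) (j : Fin p) : i.degree j ≠ 0 ↔ j ∈ i.1 := by
  unfold Idx.degree
  split_ifs with h <;> simp [h]

theorem Idx.degree_injective : Function.Injective (Idx.degree (p := p)) := by
  rintro ⟨S, m⟩ ⟨T, n⟩ h
  obtain rfl : S = T := Finset.ext fun j => by
    rw [← Idx.degree_ne_zero_iff ⟨S, m⟩ j, h, Idx.degree_ne_zero_iff ⟨T, n⟩ j]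
  congr 1
  ext j
  simpa [Idx.degree] using congrFun h j

theorem Idx.degree_surjective : Function.Surjective (Idx.degree (p := p)) := by
  intro k
  refine ⟨⟨Finset.univ.filter fun j => k j ≠ 0, fun j =>
    ⟨k j, Nat.pos_of_ne_zero (Finset.mem_filter.1 j.2).2⟩⟩, ?_⟩
  ext j
  by_cases h : k j = 0 <;> simp [Idx.degree, h]

theorem tensor_degree_eq (i : Idx p) (x : Fin p → ℝ) :
    tensor i.degree x = (∏ j : {j // j ∈ i.1}, normLegendre (i.2 j) (i.1.restrict x j)) *
      √(1 / 2) ^ (p - i.1.card) := by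
  have hin (j : {j // j ∈ i.1}) :
      normLegendre (i.degree j) (x j) = normLegendre (i.2 j) (i.1.restrict x j) := by
    simp [Idx.degree, Finset.restrict]
  have hout (j : {j // ¬ j ∈ i.1}) : normLegendre (i.degree j) (x j) = √(1 / 2) := by
    rw [Idx.degree, dif_neg j.2, normLegendre_zero]
  rw [tensor, ← Fintype.prod_subtype_mul_prod_subtype (· ∈ i.1)]
  simp only [hin, hout, Finset.prod_const, Finset.card_univ, card_notMem]
  congr!

theorem exists_measurable_tensor_degree_eq (i : Idx p) :
    ∃ h : ({j // j ∈ i.1} → ℝ) → ℝ, Measurable h ∧ ∀ x, tensor i.degree x = h (i.1.restrict x) :=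
  ⟨fun a => (∏ j, normLegendre (i.2 j) (a j)) * √(1 / 2) ^ (p - i.1.card),
    (Finset.measurable_fun_prod _ fun j _ => (continuous_normLegendre _).measurable.comp
      (measurable_pi_apply j)).mul_const _, tensor_degree_eq i⟩

namespace IsBoundedWeight

theorem integral_tensor_mul_eq_zero_of_mem_L2S (hf : IsBoundedWeight f) (hi : ¬ i.1 ⊆ S) {g : L2 f}
    (hg : g ∈ L2S f S) (u : ({j // j ∈ S} → ℝ) → ℝ) :
    ∫ x, tensor i.degree x * (g x * u (S.restrict x)) ∂(cube (Fin p)) = 0 := by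
  obtain ⟨h, -, hgh⟩ := hg
  obtain ⟨j, hji, hjS⟩ := Finset.not_subset.1 hi
  rw [← integral_tensor_mul_restrict_eq_zero hjS ((i.degree_ne_zero_iff j).2 hji)
    fun a => h a * u a]
  refine integral_congr_ae ?_
  filter_upwards [hf.ae_cube_of_ae_muF hgh] with x hx
  rw [hx]

/-- The tensor product with index `i`, as an element of `L²`. -/
def tensorLp (hf : IsBoundedWeight f) (i : Idx p) : L2 f :=
  (hf.memLp_of_continuous (continuous_tensor i.degree)).toLp

theorem coeFn_tensorLp (hf : IsBoundedWeight f) (i : Idx p) :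
    hf.tensorLp i =ᵐ[muF f] tensor i.degree :=
  MemLp.coeFn_toLp _

theorem tensorLp_mem_L2S (hf : IsBoundedWeight f) (i : Idx p) : hf.tensorLp i ∈ L2S f i.1 := by
  obtain ⟨h, hm, hh⟩ := exists_measurable_tensor_degree_eq i
  exact ⟨h, hm, (hf.coeFn_tensorLp i).mono fun x hx => hx.trans (hh x)⟩

/-- The tensor product with index `i` divided by `√f`. These vectors form the orthonormal basis of
`L²` whose image is the family `Ξ`. -/
def legendreVec (hf : IsBoundedWeight f) (i : Idx p) : L2 f :=
  hf.sqrt.inv.mulCLM f (hf.tensorLp i)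

theorem coeFn_legendreVec (hf : IsBoundedWeight f) (i : Idx p) :
    hf.legendreVec i =ᵐ[muF f] fun x => (√(f x))⁻¹ * tensor i.degree x := by
  filter_upwards [hf.sqrt.inv.coeFn_mulCLM (hf.tensorLp i), hf.coeFn_tensorLp i] with x h₁ h₂
  rw [legendreVec, h₁, h₂]

theorem inner_legendreVec (hf : IsBoundedWeight f) (i : Idx p) {g : L2 f} {u : (Fin p → ℝ) → ℝ}
    (hg : g =ᵐ[muF f] fun x => (√(f x))⁻¹ * u x) :
    inner ℝ (hf.legendreVec i) g = ∫ x, tensor i.degree x * u x ∂(cube (Fin p)) := by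
  rw [hf.inner_eq_integral_cube (hf.coeFn_legendreVec i) hg]
  refine integral_congr_ae ?_
  filter_upwards [ae_mem_cube (Fin p)] with x hx
  have hpos := hf.pos hx
  rw [mul_mul_mul_comm, ← mul_inv, Real.mul_self_sqrt hpos.le]
  field_simp

theorem orthonormal_legendreVec (hf : IsBoundedWeight f) : Orthonormal ℝ hf.legendreVec := by
  classical
  refine orthonormal_iff_ite.2 fun i j => ?_
  rw [hf.inner_legendreVec i (hf.coeFn_legendreVec j), integral_tensor_mul]
  simp only [Idx.degree_injective.eq_iff]

theorem eq_zero_of_inner_legendreVec (hf : IsBoundedWeight f) {g : L2 f}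
    (hg : ∀ i, inner ℝ (hf.legendreVec i) g = 0) : g = 0 := by
  have hgf : g =ᵐ[muF f] fun x => (√(f x))⁻¹ * (g x * √(f x)) := by
    filter_upwards [ae_muF_mem_cube f] with x hx
    have := Real.sqrt_pos.2 (hf.pos hx)
    field_simp
  have hzero : ∀ᵐ x ∂(cube (Fin p)), g x * √(f x) = 0 := by
    refine ae_eq_zero_of_integral_mul_tensor_eq_zero
      (hf.sqrt.integrable_mul (hf.integrable_coeFn g)) fun k => ?_
    obtain ⟨i, rfl⟩ := Idx.degree_surjective k
    simpa only [mul_comm] using (hf.inner_legendreVec i hgf).symm.trans (hg i)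
  rw [Lp.eq_zero_iff_ae_eq_zero]
  filter_upwards [ae_muF_of_ae_cube hzero, ae_muF_mem_cube f] with x h hx
  exact (mul_eq_zero.1 h).resolve_right (Real.sqrt_pos.2 (hf.pos hx)).ne'

/-- The orthonormal basis of `L²` formed by the Legendre tensor products divided by `√f`. -/
def legendreBasis (hf : IsBoundedWeight f) : HilbertBasis (Idx p) ℝ (L2 f) :=
  .mkOfOrthogonalEqBot hf.orthonormal_legendreVec <| (Submodule.eq_bot_iff _).2 fun _ hg =>
    hf.eq_zero_of_inner_legendreVec fun i =>
      (Submodule.mem_orthogonal _ _).1 hg _ (Submodule.subset_span ⟨i, rfl⟩)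

theorem legendreBasis_apply (hf : IsBoundedWeight f) (i : Idx p) :
    hf.legendreBasis i = hf.legendreVec i := by
  rw [legendreBasis, HilbertBasis.coe_mkOfOrthogonalEqBot]

end IsBoundedWeight

end LegendreBasis

section DualFamily

variable {p : ℕ} {f : (Fin p → ℝ) → ℝ} {S T : Finset (Fin p)}

namespace IsBoundedWeight

/-- Multiplication by `√f / f_S`, which maps the Legendre basis vector with index `(S, m_S)` to a
multiple of `ξ_S^{(m_S)}`. -/
def dualEquiv (hf : IsBoundedWeight f) (S : Finset (Fin p)) : L2 f ≃L[ℝ] L2 f :=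
  (hf.sqrt.mul (hf.marginal_restrict S).inv).mulEquiv f

theorem coeFn_dualEquiv_legendreBasis (hf : IsBoundedWeight f) (S : Finset (Fin p)) (i : Idx p) :
    hf.dualEquiv S (hf.legendreBasis i)
      =ᵐ[muF f] fun x => tensor i.degree x * (marginal f S (S.restrict x))⁻¹ := by
  rw [legendreBasis_apply]
  filter_upwards [(hf.sqrt.mul (hf.marginal_restrict S).inv).coeFn_mulEquiv (hf.legendreVec i),
    hf.coeFn_legendreVec i, ae_muF_mem_cube f] with x h₁ h₂ hx
  have := Real.sqrt_pos.2 (hf.pos hx)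
  rw [dualEquiv, h₁, h₂]
  field_simp

theorem dualEquiv_legendreBasis_mem_L2S (hf : IsBoundedWeight f) (i : Idx p) :
    hf.dualEquiv i.1 (hf.legendreBasis i) ∈ L2S f i.1 := by
  obtain ⟨h, hm, hh⟩ := exists_measurable_tensor_degree_eq i
  refine ⟨fun a => h a * (marginal f i.1 a)⁻¹,
    hm.mul (measurable_marginal hf.measurable).inv, ?_⟩
  filter_upwards [hf.coeFn_dualEquiv_legendreBasis i.1 i] with x hx
  rw [hx, hh]

theorem dualEquiv_legendreBasis_mem_hierarchicalPart (hf : IsBoundedWeight f) (i : Idx p) :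
    hf.dualEquiv i.1 (hf.legendreBasis i) ∈ hierarchicalPart (L2S f) i.1 := by
  refine mem_hierarchicalPart.2 ⟨hf.dualEquiv_legendreBasis_mem_L2S i, fun T hT h hh => ?_⟩
  have hint : ∫ x, hf.dualEquiv i.1 (hf.legendreBasis i) x * h x *
      marginal f i.1 (i.1.restrict x) ∂(cube (Fin p))
      = ∫ x, tensor i.degree x * (h x * 1) ∂(cube (Fin p)) := by
    refine integral_congr_ae ?_
    filter_upwards [hf.ae_cube_of_ae_muF (hf.coeFn_dualEquiv_legendreBasis i.1 i),
      ae_mem_cube (Fin p)] with x h₁ hx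
    have := (hf.marginal_restrict i.1).pos hx
    rw [h₁]
    field_simp
  rw [hf.integral_tensor_mul_eq_zero_of_mem_L2S (not_le_of_gt hT) hh fun _ => 1,
    ← two_pow_mul_inner_of_mem_L2S hf (hf.dualEquiv_legendreBasis_mem_L2S i)
      (monotone_L2S f hT.le hh)] at hint
  exact (mul_eq_zero.1 hint).resolve_left (by positivity)

theorem inner_legendreBasis_dualEquiv_symm (hf : IsBoundedWeight f) (i : Idx p) (g : L2 f) :
    inner ℝ (hf.legendreBasis i) ((hf.dualEquiv S).symm g)
      = ∫ x, tensor i.degree x * (g x * marginal f S (S.restrict x)) ∂(cube (Fin p)) := by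
  rw [legendreBasis_apply]
  refine hf.inner_legendreVec i ?_
  filter_upwards [(hf.sqrt.mul (hf.marginal_restrict S).inv).coeFn_mulEquiv_symm g] with x hx
  rw [dualEquiv, hx, mul_inv, inv_inv, mul_assoc, mul_comm (g x)]

theorem dualEquiv_symm_mem_basisBlock (hf : IsBoundedWeight f) {g : L2 f}
    (hg : g ∈ hierarchicalPart (L2S f) S) :
    (hf.dualEquiv S).symm g ∈ basisBlock hf.legendreBasis S := by
  obtain ⟨hgS, horth⟩ := mem_hierarchicalPart.1 hg
  refine mem_basisBlock.2 fun i hi => ?_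
  rw [hf.inner_legendreBasis_dualEquiv_symm]
  by_cases hiS : i.1 ⊆ S
  · have hinner := two_pow_mul_inner_of_mem_L2S hf
      (monotone_L2S f hiS (hf.tensorLp_mem_L2S i)) hgS
    rw [real_inner_comm, horth i.1 (hiS.lt_of_ne hi) _ (hf.tensorLp_mem_L2S i), mul_zero] at hinner
    rw [hinner]
    refine integral_congr_ae ?_
    filter_upwards [hf.ae_cube_of_ae_muF (hf.coeFn_tensorLp i)] with x hx
    rw [hx, mul_assoc]
  · exact hf.integral_tensor_mul_eq_zero_of_mem_L2S hiS hgS _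

/-- Multiplication by `f_S / f`. It replaces the density `f` by `f_S`: if `D` denotes this
operator, then `⟪g, D h⟫ = ∫ g h f_S`. -/
def marginalRatio (hf : IsBoundedWeight f) (S : Finset (Fin p)) : L2 f →L[ℝ] L2 f :=
  ((hf.marginal_restrict S).mul hf.inv).mulCLM f

theorem inner_dualEquiv_legendreBasis_marginalRatio (hf : IsBoundedWeight f) (i : Idx p)
    (h : L2 f) : inner ℝ (hf.dualEquiv S (hf.legendreBasis i)) (hf.marginalRatio S h)
      = ∫ x, tensor i.degree x * h x ∂(cube (Fin p)) := by
  rw [marginalRatio, hf.inner_eq_integral_cube (hf.coeFn_dualEquiv_legendreBasis S i)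
    (((hf.marginal_restrict S).mul hf.inv).coeFn_mulCLM h)]
  refine integral_congr_ae ?_
  filter_upwards [ae_mem_cube (Fin p)] with x hx
  have := hf.pos hx
  have := (hf.marginal_restrict S).pos hx
  field_simp

theorem inner_marginalRatio_eq_zero (hf : IsBoundedWeight f) (hST : ¬ S ⊆ T) {g h : L2 f}
    (hg : g ∈ hierarchicalPart (L2S f) S) (hh : h ∈ L2S f T) :
    inner ℝ g (hf.marginalRatio S h) = 0 := by
  have hvec (k : {j // j ∈ S} → ℕ+) : hf.dualEquiv S (hf.legendreBasis ⟨S, k⟩) ∈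
      (ℝ ∙ hf.marginalRatio S h)ᗮ := by
    rw [Submodule.mem_orthogonal_singleton_iff_inner_left,
      inner_dualEquiv_legendreBasis_marginalRatio]
    simpa only [mul_one] using
      hf.integral_tensor_mul_eq_zero_of_mem_L2S (i := ⟨S, k⟩) hST hh fun _ => 1
  have hmem := map_mem_of_mem_basisBlock (M := (hf.dualEquiv S : L2 f →L[ℝ] L2 f))
    (Submodule.isClosed_orthogonal _) hvec (hf.dualEquiv_symm_mem_basisBlock hg)
  rwa [ContinuousLinearEquiv.coe_coe, ContinuousLinearEquiv.apply_symm_apply,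
    Submodule.mem_orthogonal_singleton_iff_inner_left] at hmem

theorem exists_norm_le_mul_norm_add (hf : IsBoundedWeight f) (S : Finset (Fin p)) :
    ∃ C : ℝ, ∀ v ∈ hierarchicalPart (L2S f) S,
      ∀ u ∈ ⨆ T, ⨆ _ : ¬ S ≤ T, hierarchicalPart (L2S f) T, ‖v‖ ≤ C * ‖v + u‖ := by
  obtain ⟨c, hc, hcoercive⟩ :=
    ((hf.marginal_restrict S).mul hf.inv).exists_mul_norm_sq_le_inner_mulCLM (f := f)
  refine ⟨‖hf.marginalRatio S‖ / c, fun v hv u hu =>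
    norm_le_mul_norm_add_of_coercive hc hcoercive ?_⟩
  have hle : ⨆ T, ⨆ _ : ¬ S ≤ T, hierarchicalPart (L2S f) T
      ≤ (ℝ ∙ v)ᗮ.comap (hf.marginalRatio S).toLinearMap := by
    refine iSup₂_le fun T hT h hh => ?_
    rw [Submodule.mem_comap, Submodule.mem_orthogonal_singleton_iff_inner_right]
    exact hf.inner_marginalRatio_eq_zero hT hv (mem_hierarchicalPart.1 hh).1
  exact Submodule.mem_orthogonal_singleton_iff_inner_right.1 (hle hu)

end IsBoundedWeight

end DualFamily

section Xi

variable {p : ℕ} {f : (Fin p → ℝ) → ℝ} {κ : ℝ}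

/-- The factor between `ξ_S^{(m_S)}` and the quotient of a tensor product by `f_S`: it is `1` for
`S ≠ ∅`, and for `S = ∅` it turns the constant `2^{-p/2} / f_∅` into the prescribed `κ`. -/
def scale (f : (Fin p → ℝ) → ℝ) (κ : ℝ) (S : Finset (Fin p)) : ℝ :=
  if S = ∅ then κ * √(2 ^ p) * marginal f S (S.restrict (0 : Fin p → ℝ)) else 1

namespace IsBoundedWeight

theorem scale_ne_zero (hf : IsBoundedWeight f) (hκ : κ ≠ 0) (S : Finset (Fin p)) :
    scale f κ S ≠ 0 := by
  have := (hf.marginal_restrict S).pos (x := 0) (by simp)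
  unfold scale
  split_ifs
  · positivity
  · exact one_ne_zero

theorem xi_eq (hf : IsBoundedWeight f) (κ : ℝ) (i : Idx p) (x : Fin p → ℝ) :
    xi f κ i x
      = scale f κ i.1 * (tensor i.degree x * (marginal f i.1 (i.1.restrict x))⁻¹) := by
  have hsqrt : √(1 / 2) ^ (p - i.1.card) = 1 / √(2 ^ (p - i.1.card)) := by
    rw [Real.sqrt_div zero_le_one, Real.sqrt_one, div_pow, one_pow,
      ← Real.sqrt_sq (pow_nonneg (Real.sqrt_nonneg 2) _), pow_right_comm, Real.sq_sqrt two_pos.le]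
  rw [tensor_degree_eq, xi, scale, hsqrt]
  obtain ⟨S, m⟩ := i
  split_ifs with hS
  · obtain rfl : S = ∅ := hS
    have := ((hf.marginal_restrict ∅).pos (x := 0) (by simp)).ne'
    rw [Subsingleton.elim (Finset.restrict ∅ x) (Finset.restrict ∅ (0 : Fin p → ℝ))]
    simp only [Finset.univ_eq_empty, Finset.prod_empty, Finset.card_empty, Nat.sub_zero]
    field_simp
  · simp only [Finset.restrict]
    ring

theorem coeFn_scale_smul_dualEquiv (hf : IsBoundedWeight f) (κ : ℝ) (i : Idx p) :
    ⇑(scale f κ i.1 • hf.dualEquiv i.1 (hf.legendreBasis i)) =ᵐ[muF f] xi f κ i := by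
  filter_upwards [hf.coeFn_dualEquiv_legendreBasis i.1 i,
    Lp.coeFn_smul (scale f κ i.1) (hf.dualEquiv i.1 (hf.legendreBasis i))] with x h₁ h₂
  rw [h₂, Pi.smul_apply, h₁, hf.xi_eq, smul_eq_mul]

theorem memLp_xi (hf : IsBoundedWeight f) (κ : ℝ) (i : Idx p) : MemLp (xi f κ i) 2 (muF f) :=
  (Lp.memLp _).ae_eq (hf.coeFn_scale_smul_dualEquiv κ i)

theorem toLp_xi (hf : IsBoundedWeight f) (κ : ℝ) (i : Idx p) :
    (hf.memLp_xi κ i).toLp = scale f κ i.1 • hf.dualEquiv i.1 (hf.legendreBasis i) :=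
  Lp.ext ((hf.memLp_xi κ i).coeFn_toLp.trans (hf.coeFn_scale_smul_dualEquiv κ i).symm)

theorem toLp_xi_mem_hierarchicalPart (hf : IsBoundedWeight f) (κ : ℝ) (i : Idx p) :
    (hf.memLp_xi κ i).toLp ∈ hierarchicalPart (L2S f) i.1 :=
  hf.toLp_xi κ i ▸ Submodule.smul_mem _ _ (hf.dualEquiv_legendreBasis_mem_hierarchicalPart i)

theorem isRieszBasis_toLp_xi (hf : IsBoundedWeight f) (hκ : κ ≠ 0) :
    IsRieszBasis fun i : Idx p => (hf.memLp_xi κ i).toLp := by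
  obtain ⟨K, hK⟩ := exists_norm_le_mul_norm_sum hf.exists_norm_le_mul_norm_add
  let u (S : Finset (Fin p)) : ℝˣ := .mk0 _ (hf.scale_ne_zero hκ S)
  let M (S : Finset (Fin p)) : L2 f ≃L[ℝ] L2 f := (hf.dualEquiv S).trans (.smulLeft (u S))
  have hM (i : Idx p) : M i.1 (hf.legendreBasis i) = (hf.memLp_xi κ i).toLp :=
    (hf.toLp_xi κ i).symm
  simp only [← hM]
  refine isRieszBasis_of_blocks (isClosed_hierarchicalPart (isClosed_L2S f))
    (iSup_hierarchicalPart_L2S f) hK (fun S k => ?_) fun S v hv => ?_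
  · exact hM ⟨S, k⟩ ▸ hf.toLp_xi_mem_hierarchicalPart κ ⟨S, k⟩
  · exact hf.dualEquiv_symm_mem_basisBlock (Submodule.smul_mem _ (u S)⁻¹.1 hv)

end IsBoundedWeight

end Xi

section LeastSquares

variable {p : ℕ} {f : (Fin p → ℝ) → ℝ}

theorem objective_eq (ν : L2 f) (g : Finset (Fin p) → L2 f) :
    objective f ν g = ‖∑ S, g S - ν‖ ^ 2 := by
  rw [← real_inner_self_eq_norm_sq, inner_eq_integral_muF, objective]
  refine integral_congr_ae ?_
  filter_upwards [Lp.coeFn_sub (∑ S, g S) ν, Lp.coeFn_finsetSum Finset.univ g] with x h₁ h₂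
  rw [h₁, Pi.sub_apply, h₂, Finset.sum_apply, sq]

theorem isSolution_iff {ν : L2 f} {g : Finset (Fin p) → L2 f} (hg : Feasible f g)
    (hsum : ∑ S, g S = ν) (g' : Finset (Fin p) → L2 f) :
    IsSolution f ν g' ↔ Feasible f g' ∧ ∑ S, g' S = ν := by
  simp only [IsSolution, objective_eq]
  refine ⟨fun h => ⟨h.1, ?_⟩, fun h => ⟨h.1, fun g'' _ => ?_⟩⟩
  · have hle := h.2 g hg
    rw [hsum, sub_self, norm_zero, zero_pow two_ne_zero] at hle
    exact sub_eq_zero.1 (norm_eq_zero.1 (pow_eq_zero_iff two_ne_zero |>.1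
      (hle.antisymm (sq_nonneg _))))
  · rw [h.2, sub_self, norm_zero, zero_pow two_ne_zero]
    positivity

end LeastSquares

end FANOVA

end

theorem theorem1_general (p : ℕ) (f : (Fin p → ℝ) → ℝ) (c₁ c₂ : ℝ) (hc₁ : 0 < c₁)
    (hf : Measurable f)
    (hbound : ∀ x ∈ Set.Icc (-1 : Fin p → ℝ) 1, c₁ ≤ f x ∧ f x ≤ c₂) (κ : ℝ) (hκ : κ ≠ 0) :
    ∃ hξ : ∀ i : Idx p, MemLp (xi f κ i) 2 (muF f),
      IsRieszBasis (fun i : Idx p => (hξ i).toLp (xi f κ i)) ∧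
      ∀ ν : L2 f, ∃ (a : Idx p → ℝ) (g : Finset (Fin p) → L2 f),
        (∀ b : Idx p → ℝ, HasSum (fun i => b i • (hξ i).toLp (xi f κ i)) ν ↔ b = a) ∧
        (∀ g' : Finset (Fin p) → L2 f, IsSolution f ν g' ↔ g' = g) ∧
        (∀ g' : Finset (Fin p) → L2 f, (Feasible f g' ∧ ∑ S, g' S = ν) ↔ g' = g) ∧
        (∀ b : Idx p → ℝ, (∀ S : Finset (Fin p),
          HasSum (fun m : {j // j ∈ S} → ℕ+ => b ⟨S, m⟩ • (hξ ⟨S, m⟩).toLp (xi f κ ⟨S, m⟩))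
            (g S)) ↔ b = a) := by
  have hw : IsBoundedWeight f := ⟨hf, c₁, c₂, hc₁, hbound⟩
  have hriesz := hw.isRieszBasis_toLp_xi hκ
  obtain ⟨K, hK⟩ := exists_norm_le_mul_norm_sum hw.exists_norm_le_mul_norm_add
  refine ⟨hw.memLp_xi κ, hriesz, fun ν => ?_⟩
  obtain ⟨a, g, ha, hg, hag⟩ := hriesz.exists_hasSum_fiber_iff
    (isClosed_hierarchicalPart (isClosed_L2S f)) (hw.toLp_xi_mem_hierarchicalPart κ)
    (fun _ _ => eq_of_sum_eq_of_norm_le hK) ν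
  simp only [← feasible_iff] at hg
  obtain ⟨hfeasible, hsum⟩ := (hg g).2 rfl
  exact ⟨a, g, ha, fun g' => (isSolution_iff hfeasible hsum g').trans (hg g'), hg, hag⟩

theorem theorem1 (p : ℕ) (f : (Fin p → ℝ) → ℝ) (c₁ c₂ : ℝ) (hc₁ : 0 < c₁)
    (hf : Measurable f)
    (hbound : ∀ x ∈ Set.Icc (-1 : Fin p → ℝ) 1, c₁ ≤ f x ∧ f x ≤ c₂)
    (hdens : ∫ x in Set.Icc (-1 : Fin p → ℝ) 1, f x = 1)
    (κ : ℝ) (hκ : κ = 1 ∨ κ = 1 / Real.sqrt (2 ^ p)) :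
    ∃ hξ : ∀ i : Idx p, MemLp (xi f κ i) 2 (muF f),
      IsRieszBasis (fun i : Idx p => (hξ i).toLp (xi f κ i)) ∧
      ∀ ν : L2 f, ∃ (a : Idx p → ℝ) (g : Finset (Fin p) → L2 f),
        -- `a` is the unique coefficient family of `ν` in the basis
        (∀ b : Idx p → ℝ, HasSum (fun i => b i • (hξ i).toLp (xi f κ i)) ν ↔ b = a) ∧
        -- `g` is the unique solution of the constrained optimization problem
        (∀ g' : Finset (Fin p) → L2 f, IsSolution f ν g' ↔ g' = g) ∧
        -- `g` is the unique hierarchically orthogonal decomposition of `ν`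
        (∀ g' : Finset (Fin p) → L2 f, (Feasible f g' ∧ ∑ S, g' S = ν) ↔ g' = g) ∧
        -- the components have the coefficients `a`, and `a` is the only such family
        (∀ b : Idx p → ℝ, (∀ S : Finset (Fin p),
          HasSum (fun m : {j // j ∈ S} → ℕ+ => b ⟨S, m⟩ • (hξ ⟨S, m⟩).toLp (xi f κ ⟨S, m⟩))
            (g S)) ↔ b = a) :=
  theorem1_general p f c₁ c₂ hc₁ hf hbound κ (by rcases hκ with rfl | rfl <;> positivity)
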